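/- Let $B \neq \{0\}$ be a real separable Banach space and let $L = (L_t)_{t \ge 0}$ be a $B$-valued Lévy process on a probability space $(\Omega, \mathcal F, \mathbb P)$: $L_0 = 0$ a.s., the increments are independent, stationary and independent of the past, $L$ is stochastically continuous, and its paths are a.s. càdlàg. Suppose that $L$ is Gaussian with Lévy–Khintchine triplet $(b, Q, 0)$, where $b \in B$ and $Q : B^* \times B^* \to \mathbb R$ is a non-degenerate covariance (a non-degenerate, symmetric, positive semidefinite bilinear form), that is, $$\mathbb E\, e^{i\langle \varphi, L_t\rangle} = \exp\!\big(t\,(i\langle\varphi, b\rangle - \tfrac12 Q(\varphi,\varphi))\big), \qquad \varphi \in B^*,\ t \ge 0.$$ For $t > 0$ let $\mathcal F_t$ be the $\sigma$-algebra generated by $\{L_u : u \le t\}$ and the $\mathbb P$-null sets, and let $E^L(t) = L^2(\Omega, \mathcal F_t, \mathbb P)$ (complex-valued functions). Give $E^L = \{(t,f) : t > 0,\ f \in E^L(t)\}$ the Borel structure induced by $(0,\infty) \times L^2(\Omega, \mathcal F, \mathbb P)$, and define the product of $f \in E^L(s)$ and $g \in E^L(t)$ by $fg := f \cdot S_{s,t}\,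 g \in E^L(s+t)$, where the shift $S_{s,t}$ sends a functional $G\big((L_u)_{0 \le u \le t}\big)$ to $G\big((L_{s+u} - L_s)_{0 \le u \le t}\big)$. Then $E^L$ is a product system of Hilbert spaces: as a measurable family of Hilbert spaces it is isomorphic to the trivial bundle $(0,\infty)\times \ell^2(\mathbb N)$, and the multiplication is measurable, associative, and induces unitaries $E^L(s) \otimes E^L(t) \to E^L(s+t)$ for all $s,t>0$. Moreover $E^L$ is completely spatial (of type I): it has a unit, and for every $t > 0$ the space $E^L(t)$ is the closed linear span of the finite products $u_1(t_1) u_2(t_2) \cdots u_k(t_k)$, where $k \ge 1$, $t_1, \dots, t_k > 0$, $t_1 + \cdots + t_k = t$ and $u_1, \dots, u_k$ are units of $E^L$. Here a unit is a non-zero Borel section $t \mapsto u(t) \in E^L(t)$, $t > 0$, with $u(s+t) = u(s)u(t)$ for all $s, t > 0$. -/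

import Mathlib

open MeasureTheory ProbabilityTheory Filter Topology
open scoped NNReal ENNReal InnerProductSpace

universe u

namespace ProductSystems

/-! ### Product systems of Hilbert spaces -/

/-- The parameter semigroup `(0, ∞)`. -/
abbrev PosTime : Type := {t : ℝ≥0 // 0 < t}

/-- The data of a product system: a family of complex inner product spaces `E(t)`, `t > 0`,
a Borel structure on the total space `{(t, x) | x ∈ E(t)}` and a multiplication
`E(s) × E(t) → E(s + t)`. The laws are in `IsProductSystem`. -/
structure HilbertBundle where
  /-- the fibre `E(t)` -/
  Fiber : PosTime → Type u
  [normed : ∀ t, NormedAddCommGroup (Fiber t)]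
  [inner : ∀ t, InnerProductSpace ℂ (Fiber t)]
  /-- the Borel structure of the total space -/
  borelStructure : MeasurableSpace (Σ t, Fiber t)
  /-- the multiplication -/
  mul : ∀ {s t : PosTime}, Fiber s → Fiber t → Fiber (s + t)

attribute [instance] HilbertBundle.normed HilbertBundle.inner

namespace HilbertBundle

variable (E : HilbertBundle.{u})

/-- The total space `{(t, x) | t > 0, x ∈ E(t)}`. -/
abbrev Total : Type u := Σ t, E.Fiber t

instance : MeasurableSpace (Σ t, E.Fiber t) := E.borelStructure

/-- The Hilbert space `ℓ²(ℕ)`. -/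
abbrev EllTwo : Type := lp (fun _ : ℕ => ℂ) 2

/-- The product Borel structure of the trivial bundle `(0, ∞) × ℓ²(ℕ)`. -/
@[reducible] noncomputable def trivialBorel : MeasurableSpace (PosTime × EllTwo) :=
  MeasurableSpace.prod inferInstance (borel EllTwo)

/-- The bundle is isomorphic, as a measurable family of Hilbert spaces, to the trivial bundle
`(0, ∞) × ℓ²(ℕ)`: there are unitaries `V_t : E(t) → ℓ²(ℕ)` such that `(t, x) ↦ (t, V_t x)` is a
Borel isomorphism. -/
def IsTrivializable : Prop :=
  ∃ V : ∀ t, E.Fiber t ≃ₗᵢ[ℂ] EllTwo,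
    Measurable[E.borelStructure, trivialBorel] (fun p : Σ t, E.Fiber t => (p.1, V p.1 p.2)) ∧
    Measurable[trivialBorel, E.borelStructure]
      (fun q : PosTime × EllTwo => (⟨q.1, (V q.1).symm q.2⟩ : Σ t, E.Fiber t))

/-- `E` is a product system. The trivialization makes every fibre a separable infinite-dimensional
Hilbert space and the total space a standard Borel space whose Borel structure is compatible with
the projection, the vector space operations and the inner products. The multiplication is
measurable and associative, and it extends to unitaries `E(s) ⊗ E(t) → E(s + t)`: it is bilinear,
it multiplies inner products, and products span a dense subspace. -/
structure IsProductSystem : Prop where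
  trivializable : E.IsTrivializable
  measurable_mul : Measurable
    (fun p : E.Total × E.Total => (⟨p.1.1 + p.2.1, E.mul p.1.2 p.2.2⟩ : E.Total))
  add_mul : ∀ {s t : PosTime} (x x' : E.Fiber s) (y : E.Fiber t),
    E.mul (x + x') y = E.mul x y + E.mul x' y
  mul_add : ∀ {s t : PosTime} (x : E.Fiber s) (y y' : E.Fiber t),
    E.mul x (y + y') = E.mul x y + E.mul x y'
  smul_mul : ∀ {s t : PosTime} (c : ℂ) (x : E.Fiber s) (y : E.Fiber t),
    E.mul (c • x) y = c • E.mul x y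
  mul_smul : ∀ {s t : PosTime} (c : ℂ) (x : E.Fiber s) (y : E.Fiber t),
    E.mul x (c • y) = c • E.mul x y
  inner_mul : ∀ {s t : PosTime} (x x' : E.Fiber s) (y y' : E.Fiber t),
    ⟪E.mul x y, E.mul x' y'⟫_ℂ = ⟪x, x'⟫_ℂ * ⟪y, y'⟫_ℂ
  dense_mul : ∀ s t : PosTime, (Submodule.span ℂ
    (Set.range fun p : E.Fiber s × E.Fiber t => E.mul p.1 p.2)).topologicalClosure = ⊤
  mul_assoc : ∀ {r s t : PosTime} (x : E.Fiber r) (y : E.Fiber s) (z : E.Fiber t),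
    (⟨r + (s + t), E.mul x (E.mul y z)⟩ : E.Total) = ⟨r + s + t, E.mul (E.mul x y) z⟩

/-- A unit: a non-zero Borel section `u` with `u(s + t) = u(s) u(t)`. -/
structure IsUnitSection (v : ∀ t, E.Fiber t) : Prop where
  measurable : Measurable (fun t => (⟨t, v t⟩ : E.Total))
  ne_zero : ∃ t, v t ≠ 0
  map_add : ∀ s t, v (s + t) = E.mul (v s) (v t)

/-- `E.UnitProduct t x`: `x ∈ E(t)` is a finite product `u₁(t₁) u₂(t₂) ⋯ u_k(t_k)` of values of
units, with `k ≥ 1` and `t₁ + ⋯ + t_k = t`. -/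
inductive UnitProduct : ∀ t : PosTime, E.Fiber t → Prop
  | single (v : ∀ t, E.Fiber t) (hv : E.IsUnitSection v) (t : PosTime) : UnitProduct t (v t)
  | cons (v : ∀ t, E.Fiber t) (hv : E.IsUnitSection v) (s t : PosTime) (x : E.Fiber t)
      (hx : UnitProduct t x) : UnitProduct (s + t) (E.mul (v s) x)

/-- `E` has a unit. -/
def IsSpatial : Prop := ∃ v, E.IsUnitSection v

/-- `E` is completely spatial (of type I): it is spatial and every fibre is the closed linear span
of the finite products of values of units. -/
def IsCompletelySpatial : Prop :=
  E.IsSpatial ∧ ∀ t, (Submodule.span ℂ {x | E.UnitProduct t x}).topologicalClosure = ⊤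

end HilbertBundle

/-- The path of increments after time `s`, up to time `s + t`:
`u ↦ L_{s+u} - L_s`, `0 ≤ u ≤ t`. -/
def incrPath {Ω B : Type*} [Sub B] (L : ℝ≥0 → Ω → B) (s t : ℝ≥0) (ω : Ω) :
    Set.Iic t → B :=
  fun v => L (s + v) ω - L s ω

/-! ### Lévy processes in a separable Banach space -/

section Levy

variable {Ω : Type u} {B : Type*} [MeasurableSpace Ω] [NormedAddCommGroup B]
  [MeasurableSpace B]

/-- The σ-algebra `σ(L_u : u ≤ t)`. -/
@[reducible] def past (L : ℝ≥0 → Ω → B) (t : ℝ≥0) : MeasurableSpace Ω :=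
  ⨆ u : Set.Iic t, MeasurableSpace.comap (L u) inferInstance

/-- A `B`-valued Lévy process `L = (L_t)_{t ≥ 0}` on the probability space `(Ω, P)`. -/
structure IsLevyProcess (L : ℝ≥0 → Ω → B) (P : Measure Ω) : Prop where
  measurable : ∀ t, Measurable (L t)
  /-- stationary increments, independent of the past -/
  indep_past : ∀ t s, Indep (past L t)
    (MeasurableSpace.comap (fun ω => L (t + s) ω - L t ω) inferInstance) P
  stationary : ∀ t s, IdentDistrib (fun ω => L (t + s) ω - L t ω) (L s) P P
  /-- independent increments -/
  indep_increments : HasIndepIncrements L P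
  /-- stochastic continuity -/
  stochasticContinuity : ∀ ε : ℝ, 0 < ε → ∀ s : ℝ≥0,
    Tendsto (fun t : ℝ≥0 => P {ω | ε < ‖L (s + t) ω - L s ω‖}) (𝓝[>] 0) (𝓝 0)
  /-- càdlàg paths -/
  cadlag : ∀ᵐ ω ∂P, ∀ t : ℝ≥0, ContinuousWithinAt (fun r => L r ω) (Set.Ici t) t ∧
    ∃ l : B, Tendsto (fun r => L r ω) (𝓝[<] t) (𝓝 l)
  /-- initial condition -/
  zero : ∀ᵐ ω ∂P, L 0 ω = 0

section Triplet

variable [NormedSpace ℝ B]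

open Classical in
/-- The Lévy exponent with drift `b`, covariance `Q` and Lévy measure `ν`. -/
noncomputable def levyExponent (b : B) (Q : LinearMap.BilinForm ℝ (StrongDual ℝ B))
    (ν : Measure B) (φ : StrongDual ℝ B) : ℂ :=
  Complex.I * (φ b : ℂ) - (1 / 2 : ℂ) * (Q φ φ : ℂ) +
    ∫ x in {0}ᶜ, (Complex.exp (Complex.I * (φ x : ℂ)) - 1 -
      Complex.I * (φ x : ℂ) * (if ‖x‖ ≤ 1 then 1 else 0)) ∂ν

/-- `(b, Q, ν)` is the Lévy–Khintchine triplet of `L`: `Q` is symmetric and positive semidefinite,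
`ν` is a Lévy measure, and the characteristic function of `L_t` is `exp (t Ψ)`, where `Ψ` is the
Lévy exponent of `(b, Q, ν)`. -/
structure HasTriplet (L : ℝ≥0 → Ω → B) (P : Measure Ω) (b : B)
    (Q : LinearMap.BilinForm ℝ (StrongDual ℝ B)) (ν : Measure B) : Prop where
  symm : ∀ φ ψ, Q φ ψ = Q ψ φ
  nonneg : ∀ φ, 0 ≤ Q φ φ
  levyMeasure_zero : ν {0} = 0
  levyMeasure_lt_top : ∫⁻ x, ENNReal.ofReal (min 1 (‖x‖ ^ 2)) ∂ν < ∞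
  charFun_eq : ∀ (t : ℝ≥0) (φ : StrongDual ℝ B),
    ∫ ω, Complex.exp (Complex.I * (φ (L t ω) : ℂ)) ∂P
      = Complex.exp (((t : ℝ) : ℂ) * levyExponent b Q ν φ)

end Triplet

/-! ### The product system of a Lévy process -/

/-- The Hilbert space `E(t) = L²(Ω, 𝓕_t, P)`, where `𝓕_t` is generated by `σ(L_u : u ≤ t)` and the
null sets: the square integrable (classes of) functions on `Ω` that coincide almost everywhere
with a `σ(L_u : u ≤ t)`-measurable function. -/
noncomputable abbrev levyFiber (L : ℝ≥0 → Ω → B) (P : Measure Ω) (t : ℝ≥0) :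
    Submodule ℂ (Lp ℂ 2 P) :=
  lpMeas ℂ ℂ (past L t) 2 P

lemma past_eq_comap (L : ℝ≥0 → Ω → B) (t : ℝ≥0) :
    past L t = MeasurableSpace.comap (fun ω (v : Set.Iic t) => L v ω) MeasurableSpace.pi := by
  simp only [past, MeasurableSpace.pi, MeasurableSpace.comap_iSup, MeasurableSpace.comap_comp]
  rfl

lemma measurable_past {L : ℝ≥0 → Ω → B} {r t : ℝ≥0} (h : r ≤ t) :
    Measurable[past L t] (L r) := by
  rw [measurable_iff_comap_le]
  exact le_iSup (fun v : Set.Iic t => MeasurableSpace.comap (L v) inferInstance) ⟨r, h⟩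

lemma measurable_incrPath_aux {Ω' B' : Type*} [NormedAddCommGroup B'] [MeasurableSpace B']
    [SecondCountableTopology B'] [BorelSpace B'] {m : MeasurableSpace Ω'} {L' : ℝ≥0 → Ω' → B'}
    {s t : ℝ≥0} (h : ∀ r ≤ s + t, Measurable (L' r)) : Measurable (incrPath L' s t) := by
  refine measurable_pi_lambda _ fun v => ?_
  have h1 : s + (v : ℝ≥0) ≤ s + t := add_le_add_right v.2 s
  exact (h _ h1).sub (h s le_self_add)

/-- Every finite set of times lies on an increasing grid that starts at `0`. -/
lemma exists_grid (J : Finset ℝ≥0) :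
    ∃ (τ : ℕ → ℝ≥0) (n : ℕ), Monotone τ ∧ τ 0 = 0 ∧ ∀ r ∈ J, ∃ i ≤ n, τ i = r := by
  induction J using Finset.induction_on_max with
  | empty => exact ⟨fun _ => 0, 0, monotone_const, rfl, by simp⟩
  | insert a J ha ih =>
    obtain ⟨τ, n, hτ, h0, hJ⟩ := ih
    refine ⟨fun k => if k ≤ n then min (τ k) a else a, n + 1, ?_, by simp [h0], ?_⟩
    · intro i j hij
      dsimp only
      split_ifs with h1 h2
      · exact min_le_min_right _ (hτ hij)
      · exact min_le_right _ _
      · omega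
      · exact le_rfl
    · intro r hr
      rcases Finset.mem_insert.1 hr with rfl | hr
      · exact ⟨n + 1, le_rfl, by simp⟩
      · obtain ⟨i, hi, rfl⟩ := hJ r hr
        exact ⟨i, by omega, by simp [hi, (ha _ hr).le]⟩

variable [SecondCountableTopology B] [BorelSpace B]
  {L : ℝ≥0 → Ω → B} {P : Measure Ω}

lemma measurable_incrPath_past (s t : ℝ≥0) :
    Measurable[past L (s + t)] (incrPath L s t) :=
  measurable_incrPath_aux fun _ hr => measurable_past hr

namespace IsLevyProcess

lemma past_le (hL : IsLevyProcess L P) (t : ℝ≥0) : past L t ≤ ‹MeasurableSpace Ω› :=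
  iSup_le fun v => (hL.measurable v).comap_le

lemma measurable_incrPath (hL : IsLevyProcess L P) (s t : ℝ≥0) : Measurable (incrPath L s t) :=
  (measurable_incrPath_past s t).mono (hL.past_le _) le_rfl

variable [IsProbabilityMeasure P]

/-- The law of the path of increments does not depend on the initial time. -/
lemma identDistrib_incrPath (hL : IsLevyProcess L P) (s t : ℝ≥0) :
    IdentDistrib (incrPath L s t) (incrPath L 0 t) P P := by
  refine (identDistrib_iff_forall_finset_identDistrib
    (X := fun (v : Set.Iic t) ω => L (s + v) ω - L s ω)
    (Y := fun (v : Set.Iic t) ω => L (0 + v) ω - L 0 ω)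
    (hL.measurable_incrPath s t).aemeasurable (hL.measurable_incrPath 0 t).aemeasurable).2 ?_
  intro I
  obtain ⟨τ, n, hτ, h0, hI⟩ := exists_grid (I.image (fun v : Set.Iic t => (v : ℝ≥0)))
  have hI' : ∀ v : I, ∃ i, τ i = (v : Set.Iic t) := fun v => by
    obtain ⟨i, -, hi⟩ := hI _ (Finset.mem_image_of_mem _ v.2)
    exact ⟨i, hi⟩
  choose idx hidx using hI'
  have key : IdentDistrib (fun ω (k : ℕ) => L (s + τ (k + 1)) ω - L (s + τ k) ω)
      (fun ω (k : ℕ) => L (0 + τ (k + 1)) ω - L (0 + τ k) ω) P P := by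
    refine IdentDistrib.pi (fun k => ?_)
      (hL.indep_increments.nat (t := fun k => s + τ k) fun i j h => by dsimp only; gcongr; exact hτ h)
      (hL.indep_increments.nat (t := fun k => 0 + τ k) fun i j h => by dsimp only; gcongr; exact hτ h)
    obtain ⟨d, hd⟩ := exists_add_of_le (hτ k.le_succ)
    rw [Nat.succ_eq_add_one] at hd
    have h1 := hL.stationary (s + τ k) d
    have h2 := hL.stationary (0 + τ k) d
    rw [hd, ← add_assoc, ← add_assoc]
    exact h1.trans h2.symm
  have hΦ : Measurable (fun (y : ℕ → B) (v : I) => ∑ k ∈ Finset.range (idx v), y k) := by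
    fun_prop
  convert key.comp hΦ using 1
  · ext ω v
    simp [Finset.sum_range_sub (fun k => L (s + τ k) ω), hidx, h0]
  · ext ω v
    simp [Finset.sum_range_sub (fun k => L (τ k) ω), hidx, h0]

/-- The path of increments after time `s` is independent of the past before time `s`. -/
lemma indep_incrPath (hL : IsLevyProcess L P) (s t : ℝ≥0) :
    Indep (past L s) (MeasurableSpace.comap (incrPath L s t) MeasurableSpace.pi) P := by
  rw [past_eq_comap]
  refine (IndepFun_iff_Indep (fun ω (v : Set.Iic s) => L v ω) (incrPath L s t) P).1 ?_
  refine IndepFun.process_congr_left (X := fun (v : Set.Iic s) ω => L v ω - L 0 ω) ?_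
    (fun v => by filter_upwards [hL.zero] with ω hω; simp [hω])
  refine IndepFun.process_indepFun_process (Y := fun (v : Set.Iic t) ω => L (s + v) ω - L s ω)
    (fun v => (hL.measurable v).sub (hL.measurable 0))
    (fun v => (hL.measurable _).sub (hL.measurable s)) fun I J => ?_
  obtain ⟨τ, n, hτ, h0, hK⟩ := exists_grid
    (insert s ((I.image fun v : Set.Iic s => (v : ℝ≥0)) ∪
      J.image fun v : Set.Iic t => s + (v : ℝ≥0)))
  obtain ⟨m, hm, hms⟩ := hK s (by simp)
  have hI : ∀ v : I, ∃ i ≤ m, τ i = (v : Set.Iic s) := fun v => by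
    obtain ⟨i, -, hi⟩ := hK (v : Set.Iic s) (Finset.mem_insert_of_mem
      (Finset.mem_union_left _ (Finset.mem_image_of_mem _ v.2)))
    rcases le_total i m with h | h
    · exact ⟨i, h, hi⟩
    · refine ⟨m, le_rfl, le_antisymm (hi ▸ hτ h) ?_⟩
      rw [hms]; exact v.1.2
  have hJ : ∀ v : J, ∃ j ≤ n, m ≤ j ∧ τ j = s + (v : Set.Iic t) := fun v => by
    obtain ⟨j, hj, hj'⟩ := hK (s + (v : Set.Iic t)) (Finset.mem_insert_of_mem
      (Finset.mem_union_right _ (Finset.mem_image_of_mem _ v.2)))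
    rcases le_total m j with h | h
    · exact ⟨j, hj, h, hj'⟩
    · refine ⟨m, hm, le_rfl, le_antisymm ?_ (hj' ▸ hτ h)⟩
      rw [hms]; exact le_self_add
  choose i him hi using hI
  choose j hjn hmj hj using hJ
  have key := (hL.indep_increments.nat hτ).indepFun_finset (Finset.range m) (Finset.Ico m n)
    (by rw [Finset.disjoint_left]; intro a; simp; omega)
    (fun k => (hL.measurable _).sub (hL.measurable _))
  have hΦ : Measurable (fun (y : Finset.range m → B) (v : I) =>
      ∑ k : Finset.range m, if (k : ℕ) < i v then y k else 0) := by
    refine measurable_pi_lambda _ fun v => Finset.measurable_fun_sum _ fun k _ => ?_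
    split_ifs <;> fun_prop
  have hΨ : Measurable (fun (y : Finset.Ico m n → B) (v : J) =>
      ∑ k : Finset.Ico m n, if (k : ℕ) < j v then y k else 0) := by
    refine measurable_pi_lambda _ fun v => Finset.measurable_fun_sum _ fun k _ => ?_
    split_ifs <;> fun_prop
  convert key.comp hΦ hΨ using 1
  · ext ω v
    simp only [Function.comp]
    rw [Finset.sum_coe_sort (Finset.range m)
      (fun k => if k < i v then L (τ (k + 1)) ω - L (τ k) ω else 0), ← Finset.sum_filter]
    have : (Finset.range m).filter (fun k => k < i v) = Finset.range (i v) := by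
      ext k; have := him v; simp; omega
    rw [this, Finset.sum_range_sub (fun k => L (τ k) ω), hi, h0]
  · ext ω v
    simp only [Function.comp]
    rw [Finset.sum_coe_sort (Finset.Ico m n)
      (fun k => if k < j v then L (τ (k + 1)) ω - L (τ k) ω else 0), ← Finset.sum_filter]
    have : (Finset.Ico m n).filter (fun k => k < j v) = Finset.Ico m (j v) := by
      ext k; have := hjn v; simp; omega
    rw [this, Finset.sum_Ico_sub (fun k => L (τ k) ω) (hmj v), hj, hms]

/-- An element of `L²(Ω, 𝓕_t, P)` is almost everywhere a measurable function of the path of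
increments on `[0, t]`. -/
lemma exists_rep (hL : IsLevyProcess L P) (t : ℝ≥0) (g : levyFiber L P t) :
    ∃ G : (Set.Iic t → B) → ℂ, Measurable G ∧
      ((g : Lp ℂ 2 P) : Ω → ℂ) =ᵐ[P] G ∘ incrPath L 0 t := by
  obtain ⟨g', hg', hgg'⟩ := lpMeas.aestronglyMeasurable g
  rw [past_eq_comap] at hg'
  obtain ⟨G, hG, rfl⟩ := hg'.exists_eq_measurable_comp
  refine ⟨G, hG.measurable, hgg'.trans ?_⟩
  filter_upwards [hL.zero] with ω hω
  have h : (fun v : Set.Iic t => L v ω) = incrPath L 0 t ω := by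
    ext v
    simp [incrPath, hω]
  simp only [Function.comp, h]

/-- A measurable functional `G` of the path of increments on `[0, t]` that represents
`g ∈ L²(Ω, 𝓕_t, P)`. -/
noncomputable def rep (hL : IsLevyProcess L P) {t : ℝ≥0} (g : levyFiber L P t) :
    (Set.Iic t → B) → ℂ :=
  (hL.exists_rep t g).choose

lemma measurable_rep (hL : IsLevyProcess L P) {t : ℝ≥0} (g : levyFiber L P t) :
    Measurable (hL.rep g) :=
  (hL.exists_rep t g).choose_spec.1

lemma rep_ae_eq (hL : IsLevyProcess L P) {t : ℝ≥0} (g : levyFiber L P t) :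
    ((g : Lp ℂ 2 P) : Ω → ℂ) =ᵐ[P] hL.rep g ∘ incrPath L 0 t :=
  (hL.exists_rep t g).choose_spec.2

lemma memLp_rep_comp (hL : IsLevyProcess L P) (s : ℝ≥0) {t : ℝ≥0} (g : levyFiber L P t) :
    MemLp (hL.rep g ∘ incrPath L s t) 2 P := by
  have h := (hL.identDistrib_incrPath s t).comp (hL.measurable_rep g)
  exact h.memLp_iff.2 ((memLp_congr_ae (hL.rep_ae_eq g)).1 (Lp.memLp _))

/-- The shift operator `S_{s,t} : L²(Ω, 𝓕_t, P) → L²(Ω, 𝓕_{s,s+t}, P)`, which sends a functional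
`G((L_u)_{u ≤ t})` to `G((L_{s+u} - L_s)_{u ≤ t})`. -/
noncomputable def shift (hL : IsLevyProcess L P) (s : ℝ≥0) {t : ℝ≥0} (g : levyFiber L P t) :
    Lp ℂ 2 P :=
  (hL.memLp_rep_comp s g).toLp

/-- The shift does not depend on the functional that represents `g`. -/
lemma shift_ae_eq (hL : IsLevyProcess L P) (s : ℝ≥0) {t : ℝ≥0} (g : levyFiber L P t)
    {G : (Set.Iic t → B) → ℂ} (hG : Measurable G)
    (h : ((g : Lp ℂ 2 P) : Ω → ℂ) =ᵐ[P] G ∘ incrPath L 0 t) :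
    hL.shift s g =ᵐ[P] G ∘ incrPath L s t := by
  refine (MemLp.coeFn_toLp _).trans ?_
  have h1 : ∀ᵐ x ∂(P.map (incrPath L 0 t)), hL.rep g x = G x := by
    rw [ae_map_iff (hL.measurable_incrPath 0 t).aemeasurable
      (measurableSet_eq_fun (hL.measurable_rep g) hG)]
    exact (hL.rep_ae_eq g).symm.trans h
  rw [← (hL.identDistrib_incrPath s t).map_eq] at h1
  exact ae_of_ae_map (hL.measurable_incrPath s t).aemeasurable h1

lemma memLp_mul (hL : IsLevyProcess L P) {s t : ℝ≥0} (f : levyFiber L P s)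
    (g : levyFiber L P t) :
    MemLp (fun ω => ((f : Lp ℂ 2 P) : Ω → ℂ) ω * hL.shift s g ω) 2 P := by
  obtain ⟨f', hf', hff'⟩ := lpMeas.aestronglyMeasurable f
  have hg := hL.shift_ae_eq s g (hL.measurable_rep g) (hL.rep_ae_eq g)
  have hind : IndepFun f' (hL.rep g ∘ incrPath L s t) P := by
    rw [IndepFun_iff_Indep]
    refine indep_of_indep_of_le_left (indep_of_indep_of_le_right (hL.indep_incrPath s t) ?_)
      hf'.measurable.comap_le
    rw [← MeasurableSpace.comap_comp]
    exact MeasurableSpace.comap_mono (hL.measurable_rep g).comap_le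
  have hind' := (hind.congr hff'.symm hg.symm).comp (φ := fun z : ℂ => ‖z‖ ^ 2)
    (ψ := fun z : ℂ => ‖z‖ ^ 2) (by fun_prop) (by fun_prop)
  have hm : ∀ k : Lp ℂ 2 P, AEStronglyMeasurable (k : Ω → ℂ) P := Lp.aestronglyMeasurable
  refine (memLp_two_iff_integrable_sq_norm ((hm f).mul (hm (hL.shift s g)))).2 ?_
  have h1 := (memLp_two_iff_integrable_sq_norm (hm _)).1 (Lp.memLp (f : Lp ℂ 2 P))
  have h2 := (memLp_two_iff_integrable_sq_norm (hm _)).1 (Lp.memLp (hL.shift s g))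
  refine (hind'.integrable_mul h1 h2).congr (ae_of_all _ fun ω => ?_)
  simp [mul_pow]

lemma mul_mem (hL : IsLevyProcess L P) {s t : ℝ≥0} (f : levyFiber L P s) (g : levyFiber L P t) :
    (hL.memLp_mul f g).toLp ∈ levyFiber L P (s + t) := by
  rw [mem_lpMeas_iff_aestronglyMeasurable]
  have hf : AEStronglyMeasurable[past L (s + t)] ((f : Lp ℂ 2 P) : Ω → ℂ) P := by
    refine (lpMeas.aestronglyMeasurable f).mono ?_
    exact iSup_le fun v => (measurable_past (v.2.trans le_self_add)).comap_le
  have hg : AEStronglyMeasurable[past L (s + t)] (hL.shift s g : Ω → ℂ) P :=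
    ⟨hL.rep g ∘ incrPath L s t,
      ((hL.measurable_rep g).comp (measurable_incrPath_past s t)).stronglyMeasurable,
      hL.shift_ae_eq s g (hL.measurable_rep g) (hL.rep_ae_eq g)⟩
  exact (hf.mul hg).congr (MemLp.coeFn_toLp _).symm

/-- The product system `E^L` of a Lévy process: the fibres are `E(t) = L²(Ω, 𝓕_t, P)`, the total
space `{(t, f) | f ∈ E(t)}` has the Borel structure induced by `(0, ∞) × L²(Ω, P)`, and the product
of `f ∈ E(s)` and `g ∈ E(t)` is `f · S_{s,t} g`. -/
noncomputable def productSystem (hL : IsLevyProcess L P) : HilbertBundle.{u} where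
  Fiber t := levyFiber L P t
  borelStructure :=
    MeasurableSpace.comap (fun p => (p.1, (p.2 : Lp ℂ 2 P)))
      (MeasurableSpace.prod (inferInstance : MeasurableSpace PosTime) (borel (Lp ℂ 2 P)))
  mul f g := ⟨(hL.memLp_mul f g).toLp, hL.mul_mem f g⟩

end IsLevyProcess

end Levy

end ProductSystems

/-!
For every Lévy process and every `φ` in the dual of `B`, the section `exp (i φ(L_t))` is a unit: it
is multiplicative because the shift turns `L_t` into `L_{s + t} - L_s`. Products of such units are
the characters `exp (i ∑ φ_k(L_{u_k}))` of the path. By uniqueness of the Fourier transform on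
finite-dimensional marginals, an element of `E(t)` orthogonal to all characters of the path up to
time `t` vanishes, so these products are total in `E(t)`. The characters of the stopped path are
continuous in `t`, and a second countable space of continuous functions contains them all, so one
sequence of characters is total for all `t` at once.

Gram–Schmidt orthonormalization of a total sequence of measurable sections yields a measurable
orthonormal frame, hence the trivialization, and reduces measurability to that of inner products
with the sequence. For the multiplication the inner products factor, because a character at time
`s + t` is a product of characters at times `s` and `t`.

Finally, `E(t)` is infinite-dimensional unless `L` is deterministic. If `E(s)` contained only
constants for some `s > 0`, so would every `E(n s)`, and `L` would be deterministic; hence every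
`E(s)` with `s > 0` has dimension at least `2`. As `E(t / 2) ⊗ E(t / 2)` embeds isometrically in
`E(t)`, iterated halving of `t` produces `2 ^ n` orthonormal vectors in `E(t)`.
-/

namespace ProductSystems

/-! ### Measurable fields of Hilbert spaces -/

section MeasurableField

open InnerProductSpace (gramSchmidt gramSchmidtNormed)

lemma measurable_natNth {T : Type*} [MeasurableSpace T] {p : T → ℕ → Prop}
    (hp : ∀ n, MeasurableSet {t | p t n}) (hinf : ∀ t, {n | p t n}.Infinite) (k : ℕ) :
    Measurable fun t => Nat.nth (p t) k := by
  classical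
  have measurable_count : ∀ n, Measurable fun t => Nat.count (p t) n := fun n => by
    induction n with
    | zero => simp
    | succ n ih =>
      simp only [Nat.count_succ]
      exact ih.add (Measurable.ite (hp n) measurable_const measurable_const)
  refine measurable_to_countable' fun n => ?_
  have hpre : (fun t => Nat.nth (p t) k) ⁻¹' {n} = {t | p t n} ∩ {t | Nat.count (p t) n = k} := by
    ext t
    simp only [Set.mem_preimage, Set.mem_singleton_iff, Set.mem_inter_iff, Set.mem_ofPred_eq]
    constructor
    · rintro rfl
      exact ⟨Nat.nth_mem_of_infinite (hinf t) k, Nat.count_nth_of_infinite (hinf t) k⟩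
    · rintro ⟨hn, rfl⟩
      exact Nat.nth_count hn
  rw [hpre]
  exact (hp n).inter (measurable_count n (measurableSet_singleton k))

lemma stronglyMeasurable_comp_nat {T X : Type*} [MeasurableSpace T] [TopologicalSpace X]
    [TopologicalSpace.PseudoMetrizableSpace X] {F : ℕ → T → X}
    (hF : ∀ n, StronglyMeasurable (F n)) {N : T → ℕ} (hN : Measurable N) :
    StronglyMeasurable fun t => F (N t) t :=
  (stronglyMeasurable_uncurry_of_continuous_of_stronglyMeasurable (u := F)
    (fun _ => continuous_of_discreteTopology) hF).comp_measurable (hN.prodMk measurable_id)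

lemma stronglyMeasurable_of_hasSum_smul {T 𝕜 H : Type*} [MeasurableSpace T] [RCLike 𝕜]
    [NormedAddCommGroup H] [NormedSpace 𝕜 H] {c : ℕ → T → 𝕜} {v : ℕ → T → H} {x : T → H}
    (hc : ∀ n, Measurable (c n)) (hv : ∀ n, StronglyMeasurable (v n))
    (hx : ∀ t, HasSum (fun n => c n t • v n t) (x t)) : StronglyMeasurable x :=
  stronglyMeasurable_of_tendsto atTop
    (fun N => Finset.stronglyMeasurable_fun_sum (Finset.range N) fun n _ =>
      (hc n).stronglyMeasurable.smul (hv n))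
    (tendsto_pi_nhds.2 fun t => (hx t).tendsto_sum_nat)

variable {𝕜 : Type*} [RCLike 𝕜]

section Space

variable {E : Type*} [NormedAddCommGroup E] [InnerProductSpace 𝕜 E] {f : ℕ → E}

lemma span_range_gramSchmidtNormed (f : ℕ → E) :
    Submodule.span 𝕜 (Set.range (gramSchmidtNormed 𝕜 f)) = Submodule.span 𝕜 (Set.range f) := by
  rw [InnerProductSpace.span_gramSchmidtNormed_range, InnerProductSpace.span_gramSchmidt]

variable (𝕜) in
lemma gramSchmidt_eq_sub (f : ℕ → E) (n : ℕ) :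
    gramSchmidt 𝕜 f n = f n - ∑ i ∈ Finset.Iio n,
      (⟪gramSchmidt 𝕜 f i, f n⟫_𝕜 / (‖gramSchmidt 𝕜 f i‖ : 𝕜) ^ 2) • gramSchmidt 𝕜 f i :=
  eq_sub_of_add_eq (InnerProductSpace.gramSchmidt_def'' 𝕜 f n).symm

variable (hf : (Submodule.span 𝕜 (Set.range f)).topologicalClosure = ⊤)
  (hE : ¬ FiniteDimensional 𝕜 E)

include hf hE in
lemma infinite_gramSchmidtNormed_ne_zero : {n | gramSchmidtNormed 𝕜 f n ≠ 0}.Infinite := by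
  intro hfin
  have hrange : (Set.range (gramSchmidtNormed 𝕜 f)).Finite := by
    refine ((hfin.image (gramSchmidtNormed 𝕜 f)).insert 0).subset ?_
    rintro _ ⟨n, rfl⟩
    by_cases hn : gramSchmidtNormed 𝕜 f n = 0
    · exact Or.inl hn
    · exact Or.inr ⟨n, hn, rfl⟩
  have hspan := FiniteDimensional.span_of_finite 𝕜 hrange
  rw [span_range_gramSchmidtNormed] at hspan
  rw [(Submodule.closed_of_finiteDimensional _).submodule_topologicalClosure_eq] at hf
  rw [hf] at hspan
  exact hE (Module.finite_def.2 (Module.Finite.iff_fg.1 hspan))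

include hf hE in
lemma orthonormal_gramSchmidtNormed_nth :
    Orthonormal 𝕜 fun k =>
      gramSchmidtNormed 𝕜 f (Nat.nth (fun n => gramSchmidtNormed 𝕜 f n ≠ 0) k) :=
  have hinf := infinite_gramSchmidtNormed_ne_zero hf hE
  (InnerProductSpace.gramSchmidtNormed_orthonormal' f).comp
    (fun k => (⟨_, Nat.nth_mem_of_infinite hinf k⟩ : {n // gramSchmidtNormed 𝕜 f n ≠ 0}))
    fun _ _ hij => Nat.nth_injective hinf (congrArg Subtype.val hij)

include hf hE in
lemma top_le_closure_span_gramSchmidtNormed_nth :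
    ⊤ ≤ (Submodule.span 𝕜 (Set.range fun k => gramSchmidtNormed 𝕜 f
      (Nat.nth (fun n => gramSchmidtNormed 𝕜 f n ≠ 0) k))).topologicalClosure := by
  rw [← hf, ← span_range_gramSchmidtNormed]
  refine Submodule.topologicalClosure_mono (Submodule.span_le.2 ?_)
  rintro _ ⟨n, rfl⟩
  by_cases hn : gramSchmidtNormed 𝕜 f n = 0
  · simp [hn]
  · obtain ⟨k, rfl⟩ : n ∈ Set.range (Nat.nth fun n => gramSchmidtNormed 𝕜 f n ≠ 0) := by
      rwa [Nat.range_nth_of_infinite (infinite_gramSchmidtNormed_ne_zero hf hE)]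
    exact Submodule.subset_span ⟨k, rfl⟩

/-- The Hilbert basis obtained from a total sequence `f` of an infinite-dimensional Hilbert space
by Gram-Schmidt orthonormalization: its `k`-th vector is the `k`-th non-zero term of
`gramSchmidtNormed 𝕜 f`. -/
noncomputable def gramSchmidtHilbertBasis [CompleteSpace E] : HilbertBasis ℕ 𝕜 E :=
  HilbertBasis.mk (orthonormal_gramSchmidtNormed_nth hf hE)
    (top_le_closure_span_gramSchmidtNormed_nth hf hE)

lemma gramSchmidtHilbertBasis_apply [CompleteSpace E] (k : ℕ) :
    gramSchmidtHilbertBasis hf hE k =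
      gramSchmidtNormed 𝕜 f (Nat.nth (fun n => gramSchmidtNormed 𝕜 f n ≠ 0) k) := by
  rw [gramSchmidtHilbertBasis, HilbertBasis.coe_mk]

end Space

variable {T H : Type*} [MeasurableSpace T] [NormedAddCommGroup H] [InnerProductSpace 𝕜 H]
  {K : T → Type*} [∀ t, NormedAddCommGroup (K t)] [∀ t, InnerProductSpace 𝕜 (K t)]
  {ι : ∀ t, K t →ₗᵢ[𝕜] H}

section GramSchmidt

variable {d : ℕ → ∀ t, K t}

lemma stronglyMeasurable_gramSchmidt (hd : ∀ n, StronglyMeasurable fun t => ι t (d n t)) (n : ℕ) :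
    StronglyMeasurable fun t => ι t (gramSchmidt 𝕜 (d · t) n) := by
  induction n using Nat.strong_induction_on with
  | _ n ih =>
    simp_rw [gramSchmidt_eq_sub 𝕜 _ n, map_sub, map_sum, map_smul, ← (ι _).inner_map_map,
      ← (ι _).norm_map]
    refine (hd n).sub (Finset.stronglyMeasurable_fun_sum _ fun i hi => ?_)
    have hi := ih i (Finset.mem_Iio.1 hi)
    exact ((hi.inner (𝕜 := 𝕜) (hd n)).measurable.div
      ((RCLike.measurable_ofReal.comp hi.norm.measurable).pow_const 2)).stronglyMeasurable.smul hi

lemma measurable_inner_gramSchmidt (hd : ∀ n, StronglyMeasurable fun t => ι t (d n t))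
    {x : ∀ t, K t} (hx : ∀ n, Measurable fun t => ⟪d n t, x t⟫_𝕜) (n : ℕ) :
    Measurable fun t => ⟪gramSchmidt 𝕜 (d · t) n, x t⟫_𝕜 := by
  induction n using Nat.strong_induction_on with
  | _ n ih =>
    simp_rw [gramSchmidt_eq_sub 𝕜 _ n, inner_sub_left, sum_inner, inner_smul_left,
      ← (ι _).inner_map_map (gramSchmidt 𝕜 _ _) (d n _), ← (ι _).norm_map]
    refine (hx n).sub (Finset.measurable_fun_sum _ fun i hi => ?_)
    have hgs := stronglyMeasurable_gramSchmidt hd i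
    exact (RCLike.continuous_conj.measurable.comp ((hgs.inner (𝕜 := 𝕜) (hd n)).measurable.div
      ((RCLike.measurable_ofReal.comp hgs.norm.measurable).pow_const 2))).mul
      (ih i (Finset.mem_Iio.1 hi))

lemma stronglyMeasurable_gramSchmidtNormed (hd : ∀ n, StronglyMeasurable fun t => ι t (d n t))
    (n : ℕ) : StronglyMeasurable fun t => ι t (gramSchmidtNormed 𝕜 (d · t) n) := by
  have hgs := stronglyMeasurable_gramSchmidt hd n
  simp_rw [gramSchmidtNormed, map_smul, ← (ι _).norm_map (gramSchmidt 𝕜 _ _)]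
  exact (RCLike.measurable_ofReal.comp hgs.norm.measurable).inv.stronglyMeasurable.smul hgs

lemma measurable_inner_gramSchmidtNormed (hd : ∀ n, StronglyMeasurable fun t => ι t (d n t))
    {x : ∀ t, K t} (hx : ∀ n, Measurable fun t => ⟪d n t, x t⟫_𝕜) (n : ℕ) :
    Measurable fun t => ⟪gramSchmidtNormed 𝕜 (d · t) n, x t⟫_𝕜 := by
  have hgs := stronglyMeasurable_gramSchmidt hd n
  simp_rw [gramSchmidtNormed, inner_smul_left, ← (ι _).norm_map (gramSchmidt 𝕜 _ _)]
  exact (RCLike.continuous_conj.measurable.comp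
    (RCLike.measurable_ofReal.comp hgs.norm.measurable).inv).mul
    (measurable_inner_gramSchmidt hd hx n)

variable (htotal : ∀ t, (Submodule.span 𝕜 (Set.range (d · t))).topologicalClosure = ⊤)
  (hinf : ∀ t, ¬ FiniteDimensional 𝕜 (K t))

include htotal hinf in
lemma measurable_nth_gramSchmidtNormed_ne_zero
    (hd : ∀ n, StronglyMeasurable fun t => ι t (d n t)) (k : ℕ) :
    Measurable fun t => Nat.nth (fun n => gramSchmidtNormed 𝕜 (d · t) n ≠ 0) k := by
  refine measurable_natNth (fun n => ?_)
    (fun t => infinite_gramSchmidtNormed_ne_zero (htotal t) (hinf t)) k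
  have hnorm := (stronglyMeasurable_gramSchmidtNormed hd n).norm.measurable
  convert (hnorm (measurableSet_singleton 0)).compl using 1
  ext t
  simp

variable [∀ t, CompleteSpace (K t)]

lemma stronglyMeasurable_gramSchmidtHilbertBasis
    (hd : ∀ n, StronglyMeasurable fun t => ι t (d n t)) (k : ℕ) :
    StronglyMeasurable fun t => ι t (gramSchmidtHilbertBasis (htotal t) (hinf t) k) := by
  simp_rw [gramSchmidtHilbertBasis_apply]
  exact stronglyMeasurable_comp_nat (stronglyMeasurable_gramSchmidtNormed hd)
    (measurable_nth_gramSchmidtNormed_ne_zero htotal hinf hd k)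

lemma measurable_inner_gramSchmidtHilbertBasis
    (hd : ∀ n, StronglyMeasurable fun t => ι t (d n t)) {x : ∀ t, K t}
    (hx : ∀ n, Measurable fun t => ⟪d n t, x t⟫_𝕜) (k : ℕ) :
    Measurable fun t => ⟪gramSchmidtHilbertBasis (htotal t) (hinf t) k, x t⟫_𝕜 := by
  simp_rw [gramSchmidtHilbertBasis_apply]
  exact (stronglyMeasurable_comp_nat
    (fun n => (measurable_inner_gramSchmidtNormed hd hx n).stronglyMeasurable)
    (measurable_nth_gramSchmidtNormed_ne_zero htotal hinf hd k)).measurable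

end GramSchmidt

lemma stronglyMeasurable_of_measurable_inner_hilbertBasis {e : ∀ t, HilbertBasis ℕ 𝕜 (K t)}
    (he : ∀ n, StronglyMeasurable fun t => ι t (e t n)) {x : ∀ t, K t}
    (hx : ∀ n, Measurable fun t => ⟪e t n, x t⟫_𝕜) : StronglyMeasurable fun t => ι t (x t) := by
  refine stronglyMeasurable_of_hasSum_smul hx he fun t => ?_
  simpa [HilbertBasis.repr_apply_apply, Function.comp_def] using
    ((e t).hasSum_repr (x t)).map (ι t) (ι t).continuous

lemma stronglyMeasurable_of_measurable_inner [∀ t, CompleteSpace (K t)] {d : ℕ → ∀ t, K t}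
    (htotal : ∀ t, (Submodule.span 𝕜 (Set.range (d · t))).topologicalClosure = ⊤)
    (hinf : ∀ t, ¬ FiniteDimensional 𝕜 (K t))
    (hd : ∀ n, StronglyMeasurable fun t => ι t (d n t)) {x : ∀ t, K t}
    (hx : ∀ n, Measurable fun t => ⟪d n t, x t⟫_𝕜) : StronglyMeasurable fun t => ι t (x t) :=
  stronglyMeasurable_of_measurable_inner_hilbertBasis
    (stronglyMeasurable_gramSchmidtHilbertBasis htotal hinf hd)
    (measurable_inner_gramSchmidtHilbertBasis htotal hinf hd hx)

lemma isSeparable_range_sigma_embedding {d : ℕ → ∀ t, K t}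
    (hd : ∀ n, StronglyMeasurable fun t => ι t (d n t))
    (htotal : ∀ t, (Submodule.span 𝕜 (Set.range (d · t))).topologicalClosure = ⊤) :
    TopologicalSpace.IsSeparable (Set.range fun p : Σ t, K t => ι p.1 p.2) := by
  have hsep : TopologicalSpace.IsSeparable (⋃ n, Set.range fun t => ι t (d n t)) :=
    .iUnion fun n => (hd n).isSeparable_range
  refine (hsep.span (R := 𝕜)).closure.mono ?_
  rintro _ ⟨⟨t, x⟩, rfl⟩
  have hx : x ∈ (Submodule.span 𝕜 (Set.range (d · t))).topologicalClosure := htotal t ▸ trivial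
  have hmap : Set.MapsTo (ι t) (Submodule.span 𝕜 (Set.range (d · t)))
      (Submodule.span 𝕜 (⋃ n, Set.range fun t => ι t (d n t))) := by
    intro y hy
    refine (Submodule.span_le.2 ?_ :
      _ ≤ (Submodule.span 𝕜 (⋃ n, Set.range fun t => ι t (d n t))).comap (ι t).toLinearMap) hy
    rintro _ ⟨n, rfl⟩
    exact Submodule.subset_span (Set.mem_iUnion.2 ⟨n, t, rfl⟩)
  exact map_mem_closure (ι t).continuous hx hmap

end MeasurableField

namespace HilbertBundle

lemma injective_sigma_embedding {E : HilbertBundle.{u}} {H : Type*} [NormedAddCommGroup H]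
    [InnerProductSpace ℂ H] (ι : ∀ t, E.Fiber t →ₗᵢ[ℂ] H) :
    Function.Injective fun p : E.Total => (p.1, ι p.1 p.2) := by
  rintro ⟨s, x⟩ ⟨t, y⟩ h
  obtain ⟨rfl, hxy⟩ := Prod.ext_iff.1 h
  exact Sigma.ext rfl (heq_of_eq ((ι s).injective hxy))

/-- The Borel structure of the total space of `E` is the one induced by `(0, ∞) × H`, where the
fibre `E(t)` is regarded as a subspace of the Hilbert space `H` through the isometry `ι t`. -/
def IsInducedBy (E : HilbertBundle.{u}) {H : Type*} [NormedAddCommGroup H]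
    [InnerProductSpace ℂ H] (ι : ∀ t, E.Fiber t →ₗᵢ[ℂ] H) : Prop :=
  E.borelStructure = MeasurableSpace.comap (fun p => (p.1, ι p.1 p.2))
    (MeasurableSpace.prod (inferInstance : MeasurableSpace PosTime) (borel H))

namespace IsInducedBy

variable {E : HilbertBundle.{u}} {H : Type*} [NormedAddCommGroup H] [InnerProductSpace ℂ H]
  {ι : ∀ t, E.Fiber t →ₗᵢ[ℂ] H}

lemma measurable_iff [MeasurableSpace H] [BorelSpace H] (hι : E.IsInducedBy ι) {X : Type*}
    [MeasurableSpace X] {f : X → E.Total} :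
    Measurable f ↔ Measurable (fun x => (f x).1) ∧ Measurable fun x => ι (f x).1 (f x).2 := by
  borelize H
  change Measurable[_, E.borelStructure] f ↔ _
  rw [hι, measurable_comap_iff]
  exact ⟨fun h => ⟨h.fst, h.snd⟩, fun h => h.1.prodMk h.2⟩

lemma measurable_fst (hι : E.IsInducedBy ι) : Measurable fun p : E.Total => p.1 := by
  borelize H
  exact (hι.measurable_iff.1 measurable_id).1

variable {d : ℕ → ∀ t, E.Fiber t} (hd : ∀ n, StronglyMeasurable fun t => ι t (d n t))
  (htotal : ∀ t, (Submodule.span ℂ (Set.range (d · t))).topologicalClosure = ⊤)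

include hd htotal in
lemma stronglyMeasurable_embedding (hι : E.IsInducedBy ι) :
    StronglyMeasurable fun p : E.Total => ι p.1 p.2 := by
  borelize H
  exact stronglyMeasurable_iff_measurable_separable.2
    ⟨(hι.measurable_iff.1 measurable_id).2, isSeparable_range_sigma_embedding hd htotal⟩

variable [∀ t, CompleteSpace (E.Fiber t)] (hinf : ∀ t, ¬ FiniteDimensional ℂ (E.Fiber t))

include hd htotal hinf in
lemma isTrivializable (hι : E.IsInducedBy ι) : E.IsTrivializable := by
  borelize H EllTwo
  set e : ∀ t, HilbertBasis ℕ ℂ (E.Fiber t) := fun t =>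
    gramSchmidtHilbertBasis (htotal t) (hinf t)
  have he : ∀ n, StronglyMeasurable fun t => ι t (e t n) :=
    stronglyMeasurable_gramSchmidtHilbertBasis htotal hinf hd
  have measurable_repr_apply (n : ℕ) : Measurable fun p : E.Total => (e p.1).repr p.2 n := by
    simp_rw [HilbertBasis.repr_apply_apply, ← (ι _).inner_map_map]
    exact (((he n).comp_measurable hι.measurable_fst).inner (𝕜 := ℂ)
      (hι.stronglyMeasurable_embedding hd htotal)).measurable
  have measurable_eval (n : ℕ) : Measurable fun q : PosTime × EllTwo => q.2 n :=
    (lp.evalCLM (𝕜 := ℂ) (E := fun _ : ℕ => ℂ) (p := 2) n).continuous.measurable.comp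
      measurable_snd
  refine ⟨fun t => (e t).repr, hι.measurable_fst.prodMk (StronglyMeasurable.measurable ?_),
    hι.measurable_iff.2 ⟨_root_.measurable_fst, StronglyMeasurable.measurable ?_⟩⟩
  · refine stronglyMeasurable_of_hasSum_smul (v := fun n _ => (lp.single 2 n 1 : EllTwo))
      measurable_repr_apply (fun n => stronglyMeasurable_const) fun p => ?_
    convert lp.hasSum_single (E := fun _ : ℕ => ℂ) (p := 2) (by simp) ((e p.1).repr p.2)
      using 2 with n
    simp [← lp.single_smul]
  · refine stronglyMeasurable_of_hasSum_smul measurable_eval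
      (fun n => (he n).comp_measurable _root_.measurable_fst) fun q => ?_
    simpa using ((e q.1).hasSum_repr_symm q.2).mapL (ι q.1).toContinuousLinearMap

include hd htotal hinf in
/-- If the product of the sections `d n` and `b n` is again the section `d n`, then the
multiplication is determined by, and inherits its measurability from, the inner products. -/
lemma measurable_mul (hι : E.IsInducedBy ι) {b : ℕ → PosTime → ∀ t, E.Fiber t}
    (hb : ∀ n, StronglyMeasurable fun q : PosTime × PosTime => ι q.2 (b n q.1 q.2))
    (hmul : ∀ n s t, d n (s + t) = E.mul (d n s) (b n s t))
    (hinner : ∀ {s t : PosTime} (x x' : E.Fiber s) (y y' : E.Fiber t),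
      ⟪E.mul x y, E.mul x' y'⟫_ℂ = ⟪x, x'⟫_ℂ * ⟪y, y'⟫_ℂ) :
    Measurable fun p : E.Total × E.Total =>
      (⟨p.1.1 + p.2.1, E.mul p.1.2 p.2.2⟩ : E.Total) := by
  borelize H
  have hcoe := hι.stronglyMeasurable_embedding hd htotal
  have htimes : Measurable fun p : E.Total × E.Total => (p.1.1, p.2.1) :=
    (hι.measurable_fst.comp _root_.measurable_fst).prodMk (hι.measurable_fst.comp measurable_snd)
  have hadd : Measurable fun q : PosTime × PosTime => q.1 + q.2 :=
    ((_root_.measurable_fst.subtype_val).add measurable_snd.subtype_val).subtype_mk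
  refine hι.measurable_iff.2 ⟨hadd.comp htimes, StronglyMeasurable.measurable ?_⟩
  refine stronglyMeasurable_of_measurable_inner
    (ι := fun p : E.Total × E.Total => ι (p.1.1 + p.2.1)) (d := fun n p => d n (p.1.1 + p.2.1))
    (x := fun p => E.mul p.1.2 p.2.2) (fun p => htotal _) (fun p => hinf _)
    (fun n => (hd n).comp_measurable (hadd.comp htimes)) fun n => ?_
  simp_rw [hmul, hinner, ← (ι _).inner_map_map]
  exact (((hd n).comp_measurable (hι.measurable_fst.comp _root_.measurable_fst)).inner (𝕜 := ℂ)
      (hcoe.comp_measurable _root_.measurable_fst)).measurable.mul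
    (((hb n).comp_measurable htimes).inner (𝕜 := ℂ)
      (hcoe.comp_measurable measurable_snd)).measurable

end IsInducedBy

end HilbertBundle

/-! ### Fourier uniqueness for processes -/

lemma measure_ext_of_charFunDual {E : Type*} [NormedAddCommGroup E] [NormedSpace ℝ E]
    [SecondCountableTopology E] [MeasurableSpace E] [BorelSpace E] {μ ν : Measure E}
    [IsFiniteMeasure μ] [IsFiniteMeasure ν] (h : charFunDual μ = charFunDual ν) : μ = ν := by
  borelize (UniformSpace.Completion E)
  have hcoe : Measurable ((↑) : E → UniformSpace.Completion E) :=
    (UniformSpace.Completion.continuous_coe E).measurable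
  have hmap : μ.map ((↑) : E → UniformSpace.Completion E) = ν.map (↑) := by
    refine Measure.ext_of_charFunDual (funext fun φ => ?_)
    have := congrFun h (φ.comp (UniformSpace.Completion.toComplL (𝕜 := ℝ)))
    rw [charFunDual_apply, charFunDual_apply] at this ⊢
    rwa [integral_map hcoe.aemeasurable (Continuous.aestronglyMeasurable (by fun_prop)),
      integral_map hcoe.aemeasurable (Continuous.aestronglyMeasurable (by fun_prop))]
  ext S hS
  obtain ⟨S', hS', rfl⟩ : MeasurableSet[MeasurableSpace.comap ((↑) : E → UniformSpace.Completion E)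
      inferInstance] S := by
    rwa [BorelSpace.measurable_eq (α := UniformSpace.Completion E), ← borel_comap,
      ← UniformSpace.Completion.isUniformInducing_coe E |>.isInducing.eq_induced,
      ← BorelSpace.measurable_eq]
  rw [← Measure.map_apply hcoe hS', hmap, Measure.map_apply hcoe hS']

section Pairing

variable {T T' B : Type*} [NormedAddCommGroup B] [NormedSpace ℝ B]

/-- The value `∑ φ_t (x_t)` at the path `x` of a finitely supported family `ℓ = (φ_t)` of
functionals. -/
noncomputable def pathPairing (ℓ : T →₀ StrongDual ℝ B) (x : T → B) : ℝ :=
  ℓ.sum fun t φ => φ (x t)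

/-- The character `exp (i ∑ φ_t (x_t))` of the space of paths. -/
noncomputable def pathCharacter (ℓ : T →₀ StrongDual ℝ B) (x : T → B) : ℂ :=
  Complex.exp (pathPairing ℓ x * Complex.I)

@[simp]
lemma pathPairing_single (t : T) (φ : StrongDual ℝ B) (x : T → B) :
    pathPairing (Finsupp.single t φ) x = φ (x t) :=
  Finsupp.sum_single_index (by simp)

lemma pathPairing_add (ℓ ℓ' : T →₀ StrongDual ℝ B) (x : T → B) :
    pathPairing (ℓ + ℓ') x = pathPairing ℓ x + pathPairing ℓ' x :=
  Finsupp.sum_add_index' (by simp) (by simp)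

lemma pathPairing_neg (ℓ : T →₀ StrongDual ℝ B) (x : T → B) :
    pathPairing (-ℓ) x = -pathPairing ℓ x := by
  simp [pathPairing, Finsupp.sum]

lemma pathPairing_mapDomain (τ : T → T') (ℓ : T →₀ StrongDual ℝ B) (x : T' → B) :
    pathPairing (ℓ.mapDomain τ) x = pathPairing ℓ (x ∘ τ) :=
  Finsupp.sum_mapDomain_index (by simp) (by simp)

lemma pathPairing_add_right (ℓ : T →₀ StrongDual ℝ B) (x y : T → B) :
    pathPairing ℓ (x + y) = pathPairing ℓ x + pathPairing ℓ y := by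
  simp [pathPairing, Finsupp.sum_add]

lemma pathCharacter_add (ℓ ℓ' : T →₀ StrongDual ℝ B) (x : T → B) :
    pathCharacter (ℓ + ℓ') x = pathCharacter ℓ x * pathCharacter ℓ' x := by
  rw [pathCharacter, pathPairing_add, Complex.ofReal_add, add_mul, Complex.exp_add]
  rfl

lemma pathCharacter_neg (ℓ : T →₀ StrongDual ℝ B) (x : T → B) :
    pathCharacter (-ℓ) x = (starRingEnd ℂ) (pathCharacter ℓ x) := by
  simp [pathCharacter, pathPairing_neg, ← Complex.exp_conj]

lemma pathCharacter_mapDomain (τ : T → T') (ℓ : T →₀ StrongDual ℝ B) (x : T' → B) :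
    pathCharacter (ℓ.mapDomain τ) x = pathCharacter ℓ (x ∘ τ) := by
  rw [pathCharacter, pathPairing_mapDomain, pathCharacter]

lemma pathCharacter_add_right (ℓ : T →₀ StrongDual ℝ B) (x y : T → B) :
    pathCharacter ℓ (x + y) = pathCharacter ℓ x * pathCharacter ℓ y := by
  rw [pathCharacter, pathPairing_add_right, Complex.ofReal_add, add_mul, Complex.exp_add]
  rfl

@[simp]
lemma norm_pathCharacter (ℓ : T →₀ StrongDual ℝ B) (x : T → B) : ‖pathCharacter ℓ x‖ = 1 :=
  Complex.norm_exp_ofReal_mul_I _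

variable [MeasurableSpace B] [BorelSpace B]

lemma measurable_pathCharacter (ℓ : T →₀ StrongDual ℝ B) : Measurable (pathCharacter ℓ) := by
  unfold pathCharacter pathPairing
  exact Complex.measurable_exp.comp ((Complex.measurable_ofReal.comp
    (Finset.measurable_fun_sum _ fun t _ =>
      (ℓ t).continuous.measurable.comp (measurable_pi_apply t))).mul_const _)

variable {Ω : Type*} {m : MeasurableSpace Ω} {X : T → Ω → B}

lemma measurable_pathCharacter_comp (hX : ∀ t, Measurable (X t)) (ℓ : T →₀ StrongDual ℝ B) :
    Measurable fun ω => pathCharacter ℓ (X · ω) :=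
  (measurable_pathCharacter ℓ).comp (measurable_pi_lambda _ hX)

lemma integrable_pathCharacter_mul {P : Measure Ω} (hX : ∀ t, Measurable (X t)) {g : Ω → ℂ}
    (hg : Integrable g P) (ℓ : T →₀ StrongDual ℝ B) :
    Integrable (fun ω => pathCharacter ℓ (X · ω) * g ω) P :=
  hg.bdd_mul (measurable_pathCharacter_comp hX ℓ).aestronglyMeasurable
    (ae_of_all _ fun _ => (norm_pathCharacter ℓ _).le)

lemma integral_pathCharacter_mul_re_eq_zero {P : Measure Ω} (hX : ∀ t, Measurable (X t))
    {g : Ω → ℂ} (hg : Integrable g P) (h0 : ∀ ℓ, ∫ ω, pathCharacter ℓ (X · ω) * g ω ∂P = 0)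
    (ℓ : T →₀ StrongDual ℝ B) : ∫ ω, pathCharacter ℓ (X · ω) * (g ω).re ∂P = 0 := by
  have hconj : ∫ ω, pathCharacter ℓ (X · ω) * (starRingEnd ℂ) (g ω) ∂P = 0 := by
    rw [← map_zero (starRingEnd ℂ), ← h0 (-ℓ), ← integral_conj]
    simp [pathCharacter_neg]
  have hg_conj : Integrable (fun ω => (starRingEnd ℂ) (g ω)) P :=
    hg.congr' (by fun_prop) (by simp)
  simp_rw [Complex.re_eq_add_conj, ← mul_div_assoc, mul_add]
  rw [integral_div, integral_add (integrable_pathCharacter_mul hX hg ℓ)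
    (integrable_pathCharacter_mul hX hg_conj ℓ), h0, hconj, add_zero, zero_div]

variable [SecondCountableTopology B]

lemma map_eq_of_integral_pathCharacter_eq {μ μ' : Measure Ω} [IsFiniteMeasure μ]
    [IsFiniteMeasure μ'] (hX : ∀ t, Measurable (X t))
    (h : ∀ ℓ : T →₀ StrongDual ℝ B,
      ∫ ω, pathCharacter ℓ (X · ω) ∂μ = ∫ ω, pathCharacter ℓ (X · ω) ∂μ') :
    μ.map (fun ω t => X t ω) = μ'.map fun ω t => X t ω := by
  have hXm : Measurable fun ω t => X t ω := measurable_pi_lambda _ hX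
  refine IsProjectiveLimit.unique (P := fun J => (μ'.map fun ω t => X t ω).map J.restrict)
    (fun J => measure_ext_of_charFunDual (funext fun Λ => ?_)) fun _ => rfl
  classical
  have hJ : Measurable (J.restrict ∘ fun ω t => X t ω) := (Finset.measurable_restrict J).comp hXm
  simp only [charFunDual_apply, Measure.map_map (Finset.measurable_restrict J) hXm]
  rw [integral_map hJ.aemeasurable (Continuous.aestronglyMeasurable (by fun_prop)),
    integral_map hJ.aemeasurable (Continuous.aestronglyMeasurable (by fun_prop))]
  have hΛ (x : T → B) : (Λ (J.restrict x) : ℂ) = pathPairing (Finsupp.mapDomain Subtype.val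
      (Finsupp.equivFunOnFinite.symm fun t : J =>
        Λ.comp (ContinuousLinearMap.single ℝ (fun _ : J => B) t))) x := by
    rw [pathPairing_mapDomain, pathPairing, Finsupp.sum_fintype _ _ (by simp)]
    simp only [Finsupp.equivFunOnFinite_symm_apply_apply, ContinuousLinearMap.comp_apply,
      ContinuousLinearMap.single_apply, ← map_sum, Finset.univ_sum_single]
    rfl
  simp only [Function.comp_apply, hΛ]
  exact h _

end Pairing

lemma integral_withDensity_ofReal_sub {Ω E : Type*} [MeasurableSpace Ω] {P : Measure Ω}
    [NormedAddCommGroup E] [NormedSpace ℝ E] {g : Ω → ℝ} (hg : Integrable g P) {h : Ω → E}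
    (hh : AEStronglyMeasurable h P) {C : ℝ} (hC : ∀ ω, ‖h ω‖ ≤ C) :
    ∫ ω, h ω ∂(P.withDensity fun ω => ENNReal.ofReal (g ω)) -
      ∫ ω, h ω ∂(P.withDensity fun ω => ENNReal.ofReal (-g ω)) = ∫ ω, g ω • h ω ∂P := by
  have integral_eq {k : Ω → ℝ} (hk : Integrable k P) :
      ∫ ω, h ω ∂(P.withDensity fun ω => ENNReal.ofReal (k ω)) = ∫ ω, max (k ω) 0 • h ω ∂P := by
    rw [integral_withDensity_eq_integral_toReal_smul₀ hk.1.aemeasurable.ennreal_ofReal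
      (ae_of_all _ fun _ => ENNReal.ofReal_lt_top)]
    simp only [ENNReal.toReal_ofReal']
  have integrable_smul {k : Ω → ℝ} (hk : Integrable k P) :
      Integrable (fun ω => max (k ω) 0 • h ω) P :=
    hk.pos_part.smul_bdd C hh (ae_of_all _ hC)
  rw [integral_eq hg, integral_eq (k := fun ω => -g ω) hg.neg, ← integral_sub (integrable_smul hg)
    (integrable_smul (k := fun ω => -g ω) hg.neg)]
  simp only [← sub_smul, max_zero_sub_max_neg_zero_eq_self]

section Orthogonality

variable {T B Ω : Type*} [NormedAddCommGroup B] [NormedSpace ℝ B] [SecondCountableTopology B]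
  [MeasurableSpace B] [BorelSpace B] [MeasurableSpace Ω] {P : Measure Ω} {X : T → Ω → B}

lemma setIntegral_eq_zero_of_integral_pathCharacter_real (hX : ∀ t, Measurable (X t)) {g : Ω → ℝ}
    (hg : Integrable g P) (h0 : ∀ ℓ, ∫ ω, pathCharacter ℓ (X · ω) * g ω ∂P = 0) {A : Set Ω}
    (hA : MeasurableSet[MeasurableSpace.comap (fun ω t => X t ω) MeasurableSpace.pi] A) :
    ∫ ω in A, g ω ∂P = 0 := by
  have hXm : Measurable fun ω t => X t ω := measurable_pi_lambda _ hX
  have : IsFiniteMeasure (P.withDensity fun ω => ENNReal.ofReal (g ω)) :=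
    isFiniteMeasure_withDensity_ofReal hg.2
  have : IsFiniteMeasure (P.withDensity fun ω => ENNReal.ofReal (-g ω)) :=
    isFiniteMeasure_withDensity_ofReal hg.neg.2
  have hmap := map_eq_of_integral_pathCharacter_eq
    (μ := P.withDensity fun ω => ENNReal.ofReal (g ω))
    (μ' := P.withDensity fun ω => ENNReal.ofReal (-g ω)) hX fun ℓ => by
      rw [← sub_eq_zero, integral_withDensity_ofReal_sub hg
        (measurable_pathCharacter_comp hX ℓ).aestronglyMeasurable
        fun ω => (norm_pathCharacter ℓ _).le]
      simpa only [Complex.real_smul, mul_comm] using h0 ℓ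
  obtain ⟨S, hS, rfl⟩ := hA
  rw [integral_eq_lintegral_pos_part_sub_lintegral_neg_part hg.integrableOn,
    ← withDensity_apply _ (hXm hS), ← withDensity_apply _ (hXm hS), ← Measure.map_apply hXm hS,
    hmap, Measure.map_apply hXm hS, sub_self]

lemma setIntegral_eq_zero_of_integral_pathCharacter (hX : ∀ t, Measurable (X t)) {g : Ω → ℂ}
    (hg : Integrable g P) (h0 : ∀ ℓ, ∫ ω, pathCharacter ℓ (X · ω) * g ω ∂P = 0) {A : Set Ω}
    (hA : MeasurableSet[MeasurableSpace.comap (fun ω t => X t ω) MeasurableSpace.pi] A) :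
    ∫ ω in A, g ω ∂P = 0 := by
  have hre : ∫ ω in A, (g ω).re ∂P = 0 :=
    setIntegral_eq_zero_of_integral_pathCharacter_real hX hg.re
      (integral_pathCharacter_mul_re_eq_zero hX hg h0) hA
  have him : ∫ ω in A, (-Complex.I * g ω).re ∂P = 0 :=
    setIntegral_eq_zero_of_integral_pathCharacter_real hX (hg.const_mul _).re
      (integral_pathCharacter_mul_re_eq_zero hX (hg.const_mul _) fun ℓ => by
        simp_rw [mul_left_comm _ (-Complex.I)]
        rw [integral_const_mul, h0, mul_zero]) hA
  have him' : ∫ ω in A, (g ω).im ∂P = 0 := by simpa using him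
  rw [← integral_re_add_im hg.integrableOn]
  simp [hre, him']

end Orthogonality

/-! ### The multiplication -/

lemma levyFiber_ext {Ω B : Type*} [MeasurableSpace Ω] [MeasurableSpace B] {L : ℝ≥0 → Ω → B}
    {P : Measure Ω} {t : ℝ≥0} {f g : levyFiber L P t}
    (h : ((f : Lp ℂ 2 P) : Ω → ℂ) =ᵐ[P] ((g : Lp ℂ 2 P) : Ω → ℂ)) : f = g :=
  Subtype.ext (Lp.ext h)

namespace IsLevyProcess

variable {Ω : Type u} {B : Type*} [MeasurableSpace Ω] [NormedAddCommGroup B]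
  [MeasurableSpace B] [SecondCountableTopology B] [BorelSpace B]
  {L : ℝ≥0 → Ω → B} {P : Measure Ω} [IsProbabilityMeasure P]

lemma shift_ae_eq_rep (hL : IsLevyProcess L P) (s : ℝ≥0) {t : ℝ≥0} (g : levyFiber L P t) :
    hL.shift s g =ᵐ[P] hL.rep g ∘ incrPath L s t :=
  hL.shift_ae_eq s g (hL.measurable_rep g) (hL.rep_ae_eq g)

lemma shift_add (hL : IsLevyProcess L P) (s : ℝ≥0) {t : ℝ≥0} (g g' : levyFiber L P t) :
    hL.shift s (g + g') = hL.shift s g + hL.shift s g' := by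
  have h : ((g + g' : levyFiber L P t) : Lp ℂ 2 P) =ᵐ[P]
      (hL.rep g + hL.rep g') ∘ incrPath L 0 t :=
    (Lp.coeFn_add _ _).trans ((hL.rep_ae_eq g).add (hL.rep_ae_eq g'))
  refine Lp.ext ?_
  exact (hL.shift_ae_eq s _ ((hL.measurable_rep g).add (hL.measurable_rep g')) h).trans
    (((hL.shift_ae_eq_rep s g).add (hL.shift_ae_eq_rep s g')).symm.trans (Lp.coeFn_add _ _).symm)

lemma shift_smul (hL : IsLevyProcess L P) (s : ℝ≥0) {t : ℝ≥0} (c : ℂ) (g : levyFiber L P t) :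
    hL.shift s (c • g) = c • hL.shift s g := by
  have h : ((c • g : levyFiber L P t) : Lp ℂ 2 P) =ᵐ[P] (c • hL.rep g) ∘ incrPath L 0 t :=
    (Lp.coeFn_smul _ _).trans ((hL.rep_ae_eq g).const_smul c)
  refine Lp.ext ?_
  exact (hL.shift_ae_eq s _ ((hL.measurable_rep g).const_smul c) h).trans
    (((hL.shift_ae_eq_rep s g).const_smul c).symm.trans (Lp.coeFn_smul _ _).symm)

lemma inner_shift_ae_eq (hL : IsLevyProcess L P) (s : ℝ≥0) {t : ℝ≥0} (g g' : levyFiber L P t) :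
    (fun ω => ⟪hL.shift s g ω, hL.shift s g' ω⟫_ℂ) =ᵐ[P]
      (fun x => ⟪hL.rep g x, hL.rep g' x⟫_ℂ) ∘ incrPath L s t := by
  filter_upwards [hL.shift_ae_eq_rep s g, hL.shift_ae_eq_rep s g'] with ω h h'
  rw [h, h']
  rfl

lemma measurable_inner_rep (hL : IsLevyProcess L P) {t : ℝ≥0} (g g' : levyFiber L P t) :
    Measurable fun x => ⟪hL.rep g x, hL.rep g' x⟫_ℂ :=
  (hL.measurable_rep g).inner (hL.measurable_rep g')

lemma inner_shift (hL : IsLevyProcess L P) (s : ℝ≥0) {t : ℝ≥0} (g g' : levyFiber L P t) :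
    ⟪hL.shift s g, hL.shift s g'⟫_ℂ = ⟪g, g'⟫_ℂ := by
  rw [Submodule.coe_inner, L2.inner_def, L2.inner_def,
    integral_congr_ae (hL.inner_shift_ae_eq s g g'),
    ((hL.identDistrib_incrPath s t).comp (hL.measurable_inner_rep g g')).integral_eq]
  refine integral_congr_ae ?_
  filter_upwards [hL.rep_ae_eq g, hL.rep_ae_eq g'] with ω h h'
  rw [h, h']
  rfl

lemma indepFun_comp_incrPath (hL : IsLevyProcess L P) {s t : ℝ≥0} {F : Ω → ℂ}
    (hF : AEStronglyMeasurable[past L s] F P) {G : (Set.Iic t → B) → ℂ} (hG : Measurable G) :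
    IndepFun F (G ∘ incrPath L s t) P := by
  obtain ⟨F', hF', hFF'⟩ := hF
  refine IndepFun.congr ?_ hFF'.symm EventuallyEq.rfl
  exact indep_of_indep_of_le_left (indep_of_indep_of_le_right (hL.indep_incrPath s t)
    (hG.comp (comap_measurable _)).comap_le) hF'.measurable.comap_le

/-- The multiplication `f · S_{s,t} g` of the product system, for times in `[0, ∞)`. -/
noncomputable def mulFiber (hL : IsLevyProcess L P) {s t : ℝ≥0} (f : levyFiber L P s)
    (g : levyFiber L P t) : levyFiber L P (s + t) :=
  ⟨(hL.memLp_mul f g).toLp, hL.mul_mem f g⟩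

lemma mulFiber_ae_eq (hL : IsLevyProcess L P) {s t : ℝ≥0} (f : levyFiber L P s)
    (g : levyFiber L P t) :
    ((hL.mulFiber f g : Lp ℂ 2 P) : Ω → ℂ) =ᵐ[P] fun ω => (f : Lp ℂ 2 P) ω * hL.shift s g ω :=
  MemLp.coeFn_toLp (hL.memLp_mul f g)

lemma add_mulFiber (hL : IsLevyProcess L P) {s t : ℝ≥0} (f f' : levyFiber L P s)
    (g : levyFiber L P t) : hL.mulFiber (f + f') g = hL.mulFiber f g + hL.mulFiber f' g := by
  refine levyFiber_ext ?_
  filter_upwards [hL.mulFiber_ae_eq (f + f') g, hL.mulFiber_ae_eq f g, hL.mulFiber_ae_eq f' g,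
    Lp.coeFn_add (f : Lp ℂ 2 P) f',
    Lp.coeFn_add (hL.mulFiber f g : Lp ℂ 2 P) (hL.mulFiber f' g)] with ω h h₁ h₂ hadd hadd'
  rw [h, Submodule.coe_add, Submodule.coe_add, hadd, hadd', Pi.add_apply, Pi.add_apply, h₁, h₂,
    add_mul]

lemma smul_mulFiber (hL : IsLevyProcess L P) {s t : ℝ≥0} (c : ℂ) (f : levyFiber L P s)
    (g : levyFiber L P t) : hL.mulFiber (c • f) g = c • hL.mulFiber f g := by
  refine levyFiber_ext ?_
  filter_upwards [hL.mulFiber_ae_eq (c • f) g, hL.mulFiber_ae_eq f g,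
    Lp.coeFn_smul c (f : Lp ℂ 2 P), Lp.coeFn_smul c (hL.mulFiber f g : Lp ℂ 2 P)]
    with ω h h₁ hsmul hsmul'
  rw [h, Submodule.coe_smul, Submodule.coe_smul, hsmul, hsmul', Pi.smul_apply, Pi.smul_apply, h₁,
    smul_mul_assoc]

lemma mulFiber_add (hL : IsLevyProcess L P) {s t : ℝ≥0} (f : levyFiber L P s)
    (g g' : levyFiber L P t) : hL.mulFiber f (g + g') = hL.mulFiber f g + hL.mulFiber f g' := by
  refine levyFiber_ext ?_
  filter_upwards [hL.mulFiber_ae_eq f (g + g'), hL.mulFiber_ae_eq f g, hL.mulFiber_ae_eq f g',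
    Lp.coeFn_add (hL.shift s g) (hL.shift s g'),
    Lp.coeFn_add (hL.mulFiber f g : Lp ℂ 2 P) (hL.mulFiber f g')] with ω h h₁ h₂ hadd hadd'
  rw [h, shift_add, Submodule.coe_add, hadd, hadd', Pi.add_apply, Pi.add_apply, h₁, h₂, mul_add]

lemma mulFiber_smul (hL : IsLevyProcess L P) {s t : ℝ≥0} (c : ℂ) (f : levyFiber L P s)
    (g : levyFiber L P t) : hL.mulFiber f (c • g) = c • hL.mulFiber f g := by
  refine levyFiber_ext ?_
  filter_upwards [hL.mulFiber_ae_eq f (c • g), hL.mulFiber_ae_eq f g,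
    Lp.coeFn_smul c (hL.shift s g), Lp.coeFn_smul c (hL.mulFiber f g : Lp ℂ 2 P)]
    with ω h h₁ hsmul hsmul'
  rw [h, shift_smul, Submodule.coe_smul, hsmul, hsmul', Pi.smul_apply, Pi.smul_apply, h₁,
    mul_smul_comm]

lemma inner_mulFiber (hL : IsLevyProcess L P) {s t : ℝ≥0} (f f' : levyFiber L P s)
    (g g' : levyFiber L P t) :
    ⟪hL.mulFiber f g, hL.mulFiber f' g'⟫_ℂ = ⟪f, f'⟫_ℂ * ⟪g, g'⟫_ℂ := by
  have hf : AEStronglyMeasurable[past L s]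
      (fun ω => ⟪(f : Lp ℂ 2 P) ω, (f' : Lp ℂ 2 P) ω⟫_ℂ) P :=
    (lpMeas.aestronglyMeasurable f).inner (lpMeas.aestronglyMeasurable f')
  have hindep : IndepFun (fun ω => ⟪(f : Lp ℂ 2 P) ω, (f' : Lp ℂ 2 P) ω⟫_ℂ)
      (fun ω => ⟪hL.shift s g ω, hL.shift s g' ω⟫_ℂ) P :=
    (hL.indepFun_comp_incrPath hf (hL.measurable_inner_rep g g')).congr EventuallyEq.rfl
      (hL.inner_shift_ae_eq s g g').symm
  calc ⟪hL.mulFiber f g, hL.mulFiber f' g'⟫_ℂ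
      = ∫ ω, ⟪(f : Lp ℂ 2 P) ω, (f' : Lp ℂ 2 P) ω⟫_ℂ *
          ⟪hL.shift s g ω, hL.shift s g' ω⟫_ℂ ∂P := by
        rw [Submodule.coe_inner, L2.inner_def]
        refine integral_congr_ae ?_
        filter_upwards [hL.mulFiber_ae_eq f g, hL.mulFiber_ae_eq f' g'] with ω h h'
        simp only [h, h', RCLike.inner_apply, map_mul]
        ring
    _ = ⟪f, f'⟫_ℂ * ⟪hL.shift s g, hL.shift s g'⟫_ℂ := by
        rw [hindep.integral_fun_mul_eq_mul_integral (hf.mono (hL.past_le s))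
          ((Lp.aestronglyMeasurable _).inner (Lp.aestronglyMeasurable _)), Submodule.coe_inner,
          L2.inner_def, L2.inner_def]
    _ = ⟪f, f'⟫_ℂ * ⟪g, g'⟫_ℂ := by rw [inner_shift]

lemma orthonormal_mulFiber (hL : IsLevyProcess L P) {s t : ℝ≥0} {ι κ : Type*}
    {v : ι → levyFiber L P s} {w : κ → levyFiber L P t} (hv : Orthonormal ℂ v)
    (hw : Orthonormal ℂ w) : Orthonormal ℂ fun p : ι × κ => hL.mulFiber (v p.1) (w p.2) := by
  classical
  rw [orthonormal_iff_ite] at hv hw ⊢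
  rintro ⟨i, j⟩ ⟨i', j'⟩
  rw [inner_mulFiber, hv, hw, ite_zero_mul_ite_zero, mul_one]
  simp only [Prod.mk.injEq]

lemma shift_mulFiber_ae_eq (hL : IsLevyProcess L P) (r : ℝ≥0) {s t : ℝ≥0} (g : levyFiber L P s)
    (h : levyFiber L P t) :
    hL.shift r (hL.mulFiber g h) =ᵐ[P] fun ω => hL.shift r g ω * hL.shift (r + s) h ω := by
  let H : (Set.Iic (s + t) → B) → ℂ := fun x =>
    hL.rep g (fun v => x ⟨v, (Set.mem_Iic.1 v.2).trans le_self_add⟩) *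
      hL.rep h fun v => x ⟨s + v, add_le_add_right v.2 s⟩ - x ⟨s, Set.mem_Iic.2 le_self_add⟩
  have measurable_H : Measurable H := by
    refine ((hL.measurable_rep g).comp ?_).mul ((hL.measurable_rep h).comp ?_) <;> fun_prop
  have H_incrPath (r : ℝ≥0) (ω : Ω) : H (incrPath L r (s + t) ω) =
      hL.rep g (incrPath L r s ω) * hL.rep h (incrPath L (r + s) t ω) := by
    simp only [H, incrPath, sub_sub_sub_cancel_right, ← add_assoc]
    rfl
  have hgh : ((hL.mulFiber g h : Lp ℂ 2 P) : Ω → ℂ) =ᵐ[P] H ∘ incrPath L 0 (s + t) := by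
    filter_upwards [hL.mulFiber_ae_eq g h, hL.rep_ae_eq g, hL.shift_ae_eq_rep s h] with ω e e₁ e₂
    rw [e, e₁, e₂, Function.comp_apply (f := H), H_incrPath, zero_add]
    rfl
  filter_upwards [hL.shift_ae_eq r _ measurable_H hgh, hL.shift_ae_eq_rep r g,
    hL.shift_ae_eq_rep (r + s) h] with ω e e₁ e₂
  rw [e, e₁, e₂, Function.comp_apply, H_incrPath]
  rfl

lemma mulFiber_assoc (hL : IsLevyProcess L P) {r s t : ℝ≥0} (f : levyFiber L P r)
    (g : levyFiber L P s) (h : levyFiber L P t) :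
    (hL.mulFiber f (hL.mulFiber g h) : Lp ℂ 2 P) = hL.mulFiber (hL.mulFiber f g) h := by
  refine Lp.ext ?_
  filter_upwards [hL.mulFiber_ae_eq f (hL.mulFiber g h), hL.shift_mulFiber_ae_eq r g h,
    hL.mulFiber_ae_eq (hL.mulFiber f g) h, hL.mulFiber_ae_eq f g] with ω e₁ e₂ e₃ e₄
  rw [e₁, e₂, e₃, e₄, mul_assoc]

end IsLevyProcess

/-! ### Exponentials of a Lévy process -/

namespace IsLevyProcess

variable {Ω : Type u} {B : Type*} {m : MeasurableSpace Ω} [MeasurableSpace Ω]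
  [NormedAddCommGroup B] [NormedSpace ℝ B]
  [MeasurableSpace B] [BorelSpace B] {L : ℝ≥0 → Ω → B} {P : Measure Ω} [IsProbabilityMeasure P]

lemma memLp_pathCharacter (hL : IsLevyProcess L P) (ℓ : ℝ≥0 →₀ StrongDual ℝ B) :
    MemLp (fun ω => pathCharacter ℓ (L · ω)) 2 P :=
  .of_bound (measurable_pathCharacter_comp hL.measurable ℓ).aestronglyMeasurable 1
    (ae_of_all _ fun _ => (norm_pathCharacter ℓ _).le)

/-- The exponential `exp (i ∑ φ_u (L_u))` of a finitely supported family `ℓ = (φ_u)`, as an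
element of `L²(Ω, P)`. -/
noncomputable def expLp (hL : IsLevyProcess L P) (ℓ : ℝ≥0 →₀ StrongDual ℝ B) : Lp ℂ 2 P :=
  (hL.memLp_pathCharacter ℓ).toLp

lemma expLp_ae_eq (hL : IsLevyProcess L P) (ℓ : ℝ≥0 →₀ StrongDual ℝ B) :
    hL.expLp ℓ =ᵐ[P] fun ω => pathCharacter ℓ (L · ω) :=
  (hL.memLp_pathCharacter ℓ).coeFn_toLp

lemma expLp_mapDomain_ae_eq (hL : IsLevyProcess L P) (ℓ : ℝ≥0 →₀ StrongDual ℝ B)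
    (τ : ℝ≥0 → ℝ≥0) :
    hL.expLp (ℓ.mapDomain τ) =ᵐ[P] fun ω => pathCharacter ℓ fun u => L (τ u) ω := by
  filter_upwards [hL.expLp_ae_eq (ℓ.mapDomain τ)] with ω h
  rw [h, pathCharacter_mapDomain]
  rfl

lemma expLp_mapDomain_mem_lpMeas (hL : IsLevyProcess L P) (ℓ : ℝ≥0 →₀ StrongDual ℝ B)
    {τ : ℝ≥0 → ℝ≥0} (hτ : ∀ u, Measurable[m] (L (τ u))) :
    hL.expLp (ℓ.mapDomain τ) ∈ lpMeas ℂ ℂ m 2 P :=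
  mem_lpMeas_iff_aestronglyMeasurable.2 ⟨_,
    (measurable_pathCharacter_comp hτ ℓ).stronglyMeasurable, hL.expLp_mapDomain_ae_eq ℓ τ⟩

lemma norm_expLp_sub_sq (hL : IsLevyProcess L P) (k ℓ : ℝ≥0 →₀ StrongDual ℝ B) :
    ‖hL.expLp k - hL.expLp ℓ‖ ^ 2 =
      ∫ ω, ‖pathCharacter k (L · ω) - pathCharacter ℓ (L · ω)‖ ^ 2 ∂P := by
  have h := L2.inner_def (𝕜 := ℂ) (hL.expLp k - hL.expLp ℓ) (hL.expLp k - hL.expLp ℓ)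
  simp_rw [inner_self_eq_norm_sq_to_K] at h
  have h' : ‖hL.expLp k - hL.expLp ℓ‖ ^ 2 = ∫ ω, ‖(hL.expLp k - hL.expLp ℓ) ω‖ ^ 2 ∂P := by
    exact_mod_cast h
  rw [h']
  refine integral_congr_ae ?_
  filter_upwards [Lp.coeFn_sub (hL.expLp k) (hL.expLp ℓ), hL.expLp_ae_eq k,
    hL.expLp_ae_eq ℓ] with ω h_sub hk hℓ
  rw [h_sub, Pi.sub_apply, hk, hℓ]

lemma norm_expLp_add_sub_add (hL : IsLevyProcess L P) (k k' ℓ : ℝ≥0 →₀ StrongDual ℝ B) :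
    ‖hL.expLp (k + ℓ) - hL.expLp (k' + ℓ)‖ = ‖hL.expLp k - hL.expLp k'‖ := by
  rw [← sq_eq_sq₀ (norm_nonneg _) (norm_nonneg _), norm_expLp_sub_sq, norm_expLp_sub_sq]
  simp_rw [pathCharacter_add, ← sub_mul, norm_mul, norm_pathCharacter, mul_one]

lemma continuous_expLp_add (hL : IsLevyProcess L P) {X : Type*} [TopologicalSpace X]
    {k ℓ : X → ℝ≥0 →₀ StrongDual ℝ B} (hk : Continuous fun x => hL.expLp (k x))
    (hℓ : Continuous fun x => hL.expLp (ℓ x)) : Continuous fun x => hL.expLp (k x + ℓ x) := by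
  refine continuous_iff_continuousAt.2 fun x₀ => tendsto_iff_norm_sub_tendsto_zero.2 ?_
  have hk₀ := tendsto_iff_norm_sub_tendsto_zero.1 (hk.tendsto x₀)
  have hℓ₀ := tendsto_iff_norm_sub_tendsto_zero.1 (hℓ.tendsto x₀)
  refine squeeze_zero (fun _ => norm_nonneg _) (fun x => ?_) (by simpa using hk₀.add hℓ₀)
  calc ‖hL.expLp (k x + ℓ x) - hL.expLp (k x₀ + ℓ x₀)‖
      ≤ ‖hL.expLp (k x + ℓ x) - hL.expLp (k x₀ + ℓ x)‖ +
          ‖hL.expLp (k x₀ + ℓ x) - hL.expLp (k x₀ + ℓ x₀)‖ := norm_sub_le_norm_sub_add_norm_sub ..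
    _ = ‖hL.expLp (k x) - hL.expLp (k x₀)‖ + ‖hL.expLp (ℓ x) - hL.expLp (ℓ x₀)‖ := by
        rw [norm_expLp_add_sub_add, add_comm (k x₀), add_comm (k x₀), norm_expLp_add_sub_add]

lemma norm_expLp_single_sub (hL : IsLevyProcess L P) (φ : StrongDual ℝ B) (u d : ℝ≥0) :
    ‖hL.expLp (.single (u + d) φ) - hL.expLp (.single u φ)‖ =
      ‖hL.expLp (.single d φ) - hL.expLp 0‖ := by
  rw [← sq_eq_sq₀ (norm_nonneg _) (norm_nonneg _), norm_expLp_sub_sq, norm_expLp_sub_sq]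
  have hmeas : Measurable fun x : B => ‖Complex.exp (φ x * Complex.I) - 1‖ ^ 2 :=
    Continuous.measurable (by fun_prop)
  have h_left (ω : Ω) : pathCharacter (.single (u + d) φ) (L · ω) -
      pathCharacter (.single u φ) (L · ω) = pathCharacter (.single u φ) (L · ω) *
        (Complex.exp (φ (L (u + d) ω - L u ω) * Complex.I) - 1) := by
    simp only [pathCharacter, pathPairing_single]
    rw [mul_sub, mul_one, ← Complex.exp_add, map_sub, Complex.ofReal_sub]
    ring_nf
  have h_right (ω : Ω) : pathCharacter (.single d φ) (L · ω) - pathCharacter 0 (L · ω) =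
      Complex.exp (φ (L d ω) * Complex.I) - 1 := by
    simp [pathCharacter, pathPairing]
  simp_rw [h_left, h_right, norm_mul, norm_pathCharacter, one_mul]
  exact ((hL.stationary u d).comp hmeas).integral_eq

lemma tendsto_expLp_single_zero (hL : IsLevyProcess L P) (φ : StrongDual ℝ B) :
    Tendsto (fun d => hL.expLp (.single d φ)) (𝓝 0) (𝓝 (hL.expLp 0)) := by
  refine tendsto_iff_norm_sub_tendsto_zero.2 ?_
  suffices h : Tendsto (fun d => ‖hL.expLp (.single d φ) - hL.expLp 0‖ ^ 2) (𝓝 0) (𝓝 0) by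
    simpa using h.sqrt
  simp_rw [norm_expLp_sub_sq]
  rw [← integral_zero Ω ℝ (μ := P)]
  refine tendsto_integral_filter_of_dominated_convergence (fun _ => 4)
    (.of_forall fun d => ?_) (.of_forall fun d => .of_forall fun ω => ?_) (by fun_prop) ?_
  · exact (((measurable_pathCharacter_comp hL.measurable _).sub
      (measurable_pathCharacter_comp hL.measurable _)).norm.pow_const 2).aestronglyMeasurable
  · rw [norm_pow, norm_norm]
    calc ‖pathCharacter (.single d φ) (L · ω) - pathCharacter 0 (L · ω)‖ ^ 2
        ≤ (1 + 1) ^ 2 := by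
          gcongr
          exact (norm_sub_le _ _).trans_eq (by simp only [norm_pathCharacter])
      _ = 4 := by norm_num
  · filter_upwards [hL.cadlag, hL.zero] with ω h_cadlag h_zero
    have h_cont : Tendsto (L · ω) (𝓝 0) (𝓝 0) := by
      simpa [ContinuousWithinAt, h_zero] using (h_cadlag 0).1
    have h_char : Continuous fun x : B => ‖Complex.exp (φ x * Complex.I) - 1‖ ^ 2 := by fun_prop
    have := (h_char.tendsto 0).comp h_cont
    simpa [pathCharacter, pathPairing, Function.comp_def] using this

lemma continuous_expLp_single (hL : IsLevyProcess L P) (φ : StrongDual ℝ B) :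
    Continuous fun u => hL.expLp (.single u φ) := by
  refine continuous_iff_continuousAt.2 fun u₀ => tendsto_iff_norm_sub_tendsto_zero.2 ?_
  have h_norm (u : ℝ≥0) : ‖hL.expLp (.single u φ) - hL.expLp (.single u₀ φ)‖ =
      ‖hL.expLp (.single ((u - u₀) + (u₀ - u)) φ) - hL.expLp 0‖ := by
    rcases le_total u u₀ with h | h
    · rw [norm_sub_rev, tsub_eq_zero_of_le h, zero_add, ← norm_expLp_single_sub,
        add_tsub_cancel_of_le h]
    · rw [tsub_eq_zero_of_le h, add_zero, ← norm_expLp_single_sub, add_tsub_cancel_of_le h]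
  have h_dist : Tendsto (fun u => (u - u₀) + (u₀ - u)) (𝓝 u₀) (𝓝 0) := by
    have : Continuous fun u => (u - u₀) + (u₀ - u) := by fun_prop
    simpa using this.tendsto u₀
  simp_rw [h_norm]
  exact tendsto_iff_norm_sub_tendsto_zero.1 ((hL.tendsto_expLp_single_zero φ).comp h_dist)

lemma continuous_expLp_mapDomain (hL : IsLevyProcess L P) (ℓ : ℝ≥0 →₀ StrongDual ℝ B) :
    Continuous fun τ : ℝ≥0 → ℝ≥0 => hL.expLp (ℓ.mapDomain τ) := by
  induction ℓ using Finsupp.induction_linear with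
  | zero => simpa only [Finsupp.mapDomain_zero] using continuous_const
  | add k ℓ hk hℓ => simpa only [Finsupp.mapDomain_add] using hL.continuous_expLp_add hk hℓ
  | single u φ =>
    simp only [Finsupp.mapDomain_single]
    exact (hL.continuous_expLp_single φ).comp (continuous_apply u)

/-- The exponential `exp (i ∑ φ_u (L_{u ∧ t}))` of the process stopped at time `t`, as an element
of `E(t)`. -/
noncomputable def expFiber (hL : IsLevyProcess L P) (ℓ : ℝ≥0 →₀ StrongDual ℝ B) (t : ℝ≥0) :
    levyFiber L P t :=
  ⟨hL.expLp (ℓ.mapDomain (min · t)),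
    hL.expLp_mapDomain_mem_lpMeas ℓ fun _ => measurable_past (min_le_right _ _)⟩

lemma expFiber_ae_eq (hL : IsLevyProcess L P) (ℓ : ℝ≥0 →₀ StrongDual ℝ B) (t : ℝ≥0) :
    ((hL.expFiber ℓ t : Lp ℂ 2 P) : Ω → ℂ) =ᵐ[P] fun ω => pathCharacter ℓ fun u => L (min u t) ω :=
  hL.expLp_mapDomain_ae_eq ℓ _

lemma continuous_expFiber (hL : IsLevyProcess L P) (ℓ : ℝ≥0 →₀ StrongDual ℝ B) :
    Continuous fun t => (hL.expFiber ℓ t : Lp ℂ 2 P) :=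
  (hL.continuous_expLp_mapDomain ℓ).comp (continuous_pi fun _ => by fun_prop)

lemma continuous_expFiber_mapDomain_tsub (hL : IsLevyProcess L P) (ℓ : ℝ≥0 →₀ StrongDual ℝ B) :
    Continuous fun q : ℝ≥0 × ℝ≥0 => (hL.expFiber (ℓ.mapDomain (· - q.1)) q.2 : Lp ℂ 2 P) := by
  simp only [expFiber, ← Finsupp.mapDomain_comp]
  exact (hL.continuous_expLp_mapDomain ℓ).comp (continuous_pi fun _ => by fun_prop)

variable [SecondCountableTopology B]

lemma shift_expFiber_ae_eq (hL : IsLevyProcess L P) (ℓ : ℝ≥0 →₀ StrongDual ℝ B) (s t : ℝ≥0) :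
    hL.shift s (hL.expFiber ℓ t) =ᵐ[P]
      fun ω => pathCharacter ℓ fun u => L (s + min u t) ω - L s ω := by
  let G : (Set.Iic t → B) → ℂ := fun x =>
    pathCharacter ℓ fun u => x ⟨min u t, Set.mem_Iic.2 (min_le_right _ _)⟩
  have measurable_G : Measurable G :=
    (measurable_pathCharacter ℓ).comp (measurable_pi_lambda _ fun _ => measurable_pi_apply _)
  have h_rep : ((hL.expFiber ℓ t : Lp ℂ 2 P) : Ω → ℂ) =ᵐ[P] G ∘ incrPath L 0 t := by
    filter_upwards [hL.expFiber_ae_eq ℓ t, hL.zero] with ω h h_zero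
    rw [h]
    simp only [Function.comp_apply, G, incrPath, h_zero, zero_add, sub_zero]
  exact hL.shift_ae_eq s _ measurable_G h_rep

lemma expFiber_add (hL : IsLevyProcess L P) (ℓ : ℝ≥0 →₀ StrongDual ℝ B) (s t : ℝ≥0) :
    hL.expFiber ℓ (s + t) =
      hL.mulFiber (hL.expFiber ℓ s) (hL.expFiber (ℓ.mapDomain (· - s)) t) := by
  refine levyFiber_ext ?_
  filter_upwards [hL.expFiber_ae_eq ℓ (s + t), hL.mulFiber_ae_eq (hL.expFiber ℓ s)
    (hL.expFiber (ℓ.mapDomain (· - s)) t), hL.expFiber_ae_eq ℓ s,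
    hL.shift_expFiber_ae_eq (ℓ.mapDomain (· - s)) s t] with ω h h_mul h_left h_right
  rw [h, h_mul, h_left, h_right, pathCharacter_mapDomain, ← pathCharacter_add_right]
  congr 1
  ext u
  rcases le_total u s with hu | hu
  · simp [tsub_eq_zero_of_le hu, hu, hu.trans le_self_add]
  · obtain ⟨v, rfl⟩ := exists_add_of_le hu
    simp [min_add_add_left]

end IsLevyProcess

/-! ### Totality of the exponentials -/

lemma secondCountableTopology_lpMeas {Ω : Type*} {m mΩ : MeasurableSpace Ω} {P : Measure Ω}
    [IsFiniteMeasure P] (hm : m ≤ mΩ) (hm' : @MeasurableSpace.CountablyGenerated Ω m) :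
    SecondCountableTopology (lpMeas ℂ ℂ m 2 P) := by
  let : MeasurableSpace Ω := m
  have : IsFiniteMeasure (P.trim hm) := isFiniteMeasure_trim hm
  have : Fact ((2 : ℝ≥0∞) ≠ ∞) := ⟨ENNReal.ofNat_ne_top⟩
  have : SecondCountableTopology (@Lp Ω ℂ m _ 2 (P.trim hm)) :=
    Lp.SecondCountableTopology
  exact (lpMeasToLpTrimLie ℂ ℂ 2 P hm).toHomeomorph.secondCountableTopology

namespace IsLevyProcess

lemma completeSpace_levyFiber {Ω B : Type*} [MeasurableSpace Ω] [NormedAddCommGroup B]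
    [MeasurableSpace B] [BorelSpace B] [SecondCountableTopology B] {L : ℝ≥0 → Ω → B}
    {P : Measure Ω} (hL : IsLevyProcess L P) (t : ℝ≥0) :
    CompleteSpace (levyFiber L P t) :=
  have : Fact (past L t ≤ ‹MeasurableSpace Ω›) := ⟨hL.past_le t⟩
  inferInstance

variable {Ω : Type u} {B : Type*} [MeasurableSpace Ω] [NormedAddCommGroup B] [NormedSpace ℝ B]
  [MeasurableSpace B] [BorelSpace B] {L : ℝ≥0 → Ω → B} {P : Measure Ω} [IsProbabilityMeasure P]

/-- The σ-algebra `σ(L_u : u ∈ D)` of a countable dense set `D` of times. -/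
@[reducible] noncomputable def sigmaDenseTimes (L : ℝ≥0 → Ω → B) : MeasurableSpace Ω :=
  MeasurableSpace.comap (fun ω n => L (TopologicalSpace.denseSeq ℝ≥0 n) ω) MeasurableSpace.pi

lemma expLp_mem_lpMeas_sigmaDenseTimes (hL : IsLevyProcess L P) (ℓ : ℝ≥0 →₀ StrongDual ℝ B) :
    hL.expLp ℓ ∈ lpMeas ℂ ℂ (sigmaDenseTimes L) 2 P := by
  have h_le : sigmaDenseTimes L ≤ ‹MeasurableSpace Ω› :=
    (measurable_pi_lambda _ fun n => hL.measurable _).comap_le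
  have h_closed : IsClosed {τ : ℝ≥0 → ℝ≥0 |
      hL.expLp (ℓ.mapDomain τ) ∈ lpMeas ℂ ℂ (sigmaDenseTimes L) 2 P} :=
    (isClosed_aestronglyMeasurable h_le).preimage (hL.continuous_expLp_mapDomain ℓ)
  have h_dense : Dense (Set.univ.pi fun _ : ℝ≥0 => Set.range (TopologicalSpace.denseSeq ℝ≥0)) :=
    dense_pi _ fun _ _ => TopologicalSpace.denseRange_denseSeq ℝ≥0
  have h_id : id ∈ {τ : ℝ≥0 → ℝ≥0 |
      hL.expLp (ℓ.mapDomain τ) ∈ lpMeas ℂ ℂ (sigmaDenseTimes L) 2 P} := by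
    refine h_closed.closure_subset_iff.2 (fun τ hτ => ?_) (h_dense id)
    refine hL.expLp_mapDomain_mem_lpMeas ℓ fun u => ?_
    obtain ⟨n, hn⟩ := hτ u trivial
    rw [← hn]
    exact (measurable_pi_apply (X := fun _ => B) n).comp
      (comap_measurable fun ω n => L (TopologicalSpace.denseSeq ℝ≥0 n) ω)
  simpa using h_id

variable [SecondCountableTopology B]

theorem topologicalClosure_span_expFiber (hL : IsLevyProcess L P) (t : ℝ≥0) :
    (Submodule.span ℂ (Set.range fun ℓ => hL.expFiber ℓ t)).topologicalClosure = ⊤ := by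
  have := hL.completeSpace_levyFiber t
  rw [Submodule.topologicalClosure_eq_top_iff, Submodule.eq_bot_iff]
  intro g hg
  have hg_int : Integrable (g : Lp ℂ 2 P) P := (Lp.memLp (g : Lp ℂ 2 P)).integrable (by norm_num)
  have h_fourier (ℓ : Set.Iic t →₀ StrongDual ℝ B) :
      ∫ ω, pathCharacter ℓ (fun v => L v ω) * (g : Lp ℂ 2 P) ω ∂P = 0 := by
    have h_inner : ⟪hL.expFiber ((-ℓ).mapDomain Subtype.val) t, g⟫_ℂ = 0 :=
      (Submodule.mem_orthogonal _ _).1 hg _ (Submodule.subset_span ⟨_, rfl⟩)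
    rw [← h_inner, Submodule.coe_inner, L2.inner_def]
    refine integral_congr_ae ?_
    filter_upwards [hL.expFiber_ae_eq ((-ℓ).mapDomain Subtype.val) t] with ω hω
    have h_stop : (fun u => L (min u t) ω) ∘ (Subtype.val : Set.Iic t → ℝ≥0) =
        fun v : Set.Iic t => L v ω :=
      funext fun v => congrArg (L · ω) (min_eq_left v.2)
    rw [hω, RCLike.inner_apply, pathCharacter_mapDomain, h_stop, pathCharacter_neg,
      Complex.conj_conj, mul_comm]
  have h_set (A : Set Ω) (hA : MeasurableSet[past L t] A) :
      ∫ ω in A, (g : Lp ℂ 2 P) ω ∂P = 0 := by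
    rw [past_eq_comap] at hA
    exact setIntegral_eq_zero_of_integral_pathCharacter (X := fun v : Set.Iic t => L v)
      (fun v => hL.measurable v) hg_int h_fourier hA
  refine levyFiber_ext ?_
  exact (lpMeas.ae_eq_zero_of_forall_setIntegral_eq_zero (hL.past_le t) g two_ne_zero
    ENNReal.ofNat_ne_top (fun _ _ _ => hg_int.integrableOn) fun A hA _ => h_set A hA).trans
    (Lp.coeFn_zero ℂ 2 P).symm

/-- One sequence of families is dense for all times `t` simultaneously, because the functions
`t ↦ expFiber ℓ t` lie in a second countable space of continuous functions. -/
lemma exists_seq_expFiber_mem_closure (hL : IsLevyProcess L P) :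
    ∃ ℓ : ℕ → ℝ≥0 →₀ StrongDual ℝ B, ∀ k t,
      hL.expFiber k t ∈ closure (Set.range fun n => hL.expFiber (ℓ n) t) := by
  have : SecondCountableTopology (lpMeas ℂ ℂ (sigmaDenseTimes L) 2 P) :=
    secondCountableTopology_lpMeas (measurable_pi_lambda _ fun n => hL.measurable _).comap_le
      (.comap _)
  let F (k : ℝ≥0 →₀ StrongDual ℝ B) : C(ℝ≥0, lpMeas ℂ ℂ (sigmaDenseTimes L) 2 P) :=
    ⟨fun t => ⟨hL.expFiber k t, hL.expLp_mem_lpMeas_sigmaDenseTimes _⟩,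
      (hL.continuous_expFiber k).subtype_mk _⟩
  let : TopologicalSpace (ℝ≥0 →₀ StrongDual ℝ B) := .induced F inferInstance
  have : SecondCountableTopology (ℝ≥0 →₀ StrongDual ℝ B) :=
    TopologicalSpace.secondCountableTopology_induced _ _ F
  refine ⟨TopologicalSpace.denseSeq _, fun k t => ?_⟩
  have h_eval : Continuous fun k => F k t := (continuous_eval_const t).comp continuous_induced_dom
  have h_val : Continuous fun k => (F k t : Lp ℂ 2 P) := continuous_subtype_val.comp h_eval
  have h_cont : Continuous fun k => hL.expFiber k t := continuous_induced_rng.2 h_val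
  refine map_mem_closure h_cont (TopologicalSpace.denseRange_denseSeq _ k) ?_
  rintro _ ⟨n, rfl⟩
  exact ⟨n, rfl⟩

lemma exists_seq_topologicalClosure_span_expFiber (hL : IsLevyProcess L P) :
    ∃ ℓ : ℕ → ℝ≥0 →₀ StrongDual ℝ B, ∀ t,
      (Submodule.span ℂ (Set.range fun n => hL.expFiber (ℓ n) t)).topologicalClosure = ⊤ := by
  obtain ⟨ℓ, hℓ⟩ := hL.exists_seq_expFiber_mem_closure
  refine ⟨ℓ, fun t => top_unique ?_⟩
  rw [← hL.topologicalClosure_span_expFiber t]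
  refine Submodule.topologicalClosure_minimal _ (Submodule.span_le.2 ?_)
    (Submodule.isClosed_topologicalClosure _)
  rintro _ ⟨k, rfl⟩
  exact closure_mono Submodule.subset_span (hℓ k t)

end IsLevyProcess

/-! ### Units -/

lemma card_interior_mapDomain_tsub_lt {M : Type*} [AddCommMonoid M] {ℓ : ℝ≥0 →₀ M} {s t : ℝ≥0}
    (hs : s ∈ ℓ.support) (h0 : 0 < s) (ht : 0 < t) :
    Finset.card {u ∈ (ℓ.mapDomain (· - s)).support | 0 < u ∧ u < t} <
      Finset.card {u ∈ ℓ.support | 0 < u ∧ u < s + t} := by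
  classical
  have hs' : s ∈ ({u ∈ ℓ.support | 0 < u ∧ u < s + t} : Finset ℝ≥0) :=
    Finset.mem_filter.2 ⟨hs, h0, lt_add_of_pos_right s ht⟩
  refine lt_of_le_of_lt ?_ (Finset.card_erase_lt_of_mem hs')
  refine (Finset.card_le_card (t := (Finset.erase _ s).image (· - s)) fun u hu => ?_).trans
    Finset.card_image_le
  obtain ⟨hu_mem, hu_pos, hu_lt⟩ := Finset.mem_filter.1 hu
  obtain ⟨v, hv, rfl⟩ := Finset.mem_image.1 (Finsupp.mapDomain_support hu_mem)
  have hsv : s < v := tsub_pos_iff_lt.1 hu_pos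
  refine Finset.mem_image_of_mem _ (Finset.mem_erase.2 ⟨hsv.ne', Finset.mem_filter.2
    ⟨hv, h0.trans hsv, ?_⟩⟩)
  exact (tsub_lt_iff_left hsv.le).1 hu_lt

namespace IsLevyProcess

lemma isInducedBy_productSystem {Ω : Type u} {B : Type*} [MeasurableSpace Ω]
    [NormedAddCommGroup B] [MeasurableSpace B] [SecondCountableTopology B] [BorelSpace B]
    {L : ℝ≥0 → Ω → B} {P : Measure Ω} [IsProbabilityMeasure P] (hL : IsLevyProcess L P) :
    hL.productSystem.IsInducedBy fun t => (levyFiber L P t).subtypeₗᵢ :=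
  rfl

variable {Ω : Type u} {B : Type*} [MeasurableSpace Ω] [NormedAddCommGroup B] [NormedSpace ℝ B]
  [MeasurableSpace B] [BorelSpace B] {L : ℝ≥0 → Ω → B} {P : Measure Ω} [IsProbabilityMeasure P]

/-- The exponential `exp (i φ(L_t))`, as an element of `E(t)`. -/
noncomputable def expUnit (hL : IsLevyProcess L P) (φ : StrongDual ℝ B) (t : ℝ≥0) :
    levyFiber L P t :=
  hL.expFiber (.single t φ) t

lemma coe_expUnit (hL : IsLevyProcess L P) (φ : StrongDual ℝ B) (t : ℝ≥0) :
    (hL.expUnit φ t : Lp ℂ 2 P) = hL.expLp (.single t φ) := by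
  simp only [expUnit, expFiber, Finsupp.mapDomain_single, min_self]

lemma expFiber_eq_expUnit (hL : IsLevyProcess L P) {ℓ : ℝ≥0 →₀ StrongDual ℝ B} {t : ℝ≥0}
    (hℓ : ∀ u ∈ ℓ.support, u = 0 ∨ t ≤ u) :
    hL.expFiber ℓ t = hL.expUnit (∑ u ∈ ℓ.support.erase 0, ℓ u) t := by
  refine levyFiber_ext ?_
  filter_upwards [hL.expFiber_ae_eq ℓ t, hL.expFiber_ae_eq (.single t _) t, hL.zero]
    with ω h h_unit h_zero
  rw [h, expUnit, h_unit, pathCharacter, pathCharacter, pathPairing_single, min_self,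
    sum_apply, pathPairing, Finsupp.sum,
    ← Finset.sum_erase (a := 0) _ (by simp [h_zero])]
  congr 3
  refine Finset.sum_congr rfl fun u hu => ?_
  rw [min_eq_right ((hℓ u (Finset.mem_of_mem_erase hu)).resolve_left (Finset.ne_of_mem_erase hu))]

variable [SecondCountableTopology B]

lemma expUnit_add (hL : IsLevyProcess L P) (φ : StrongDual ℝ B) (s t : ℝ≥0) :
    hL.expUnit φ (s + t) = hL.mulFiber (hL.expUnit φ s) (hL.expUnit φ t) := by
  have h_left : hL.expFiber (.single (s + t) φ) s = hL.expUnit φ s :=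
    Subtype.ext <| by
      simp only [expUnit, expFiber, Finsupp.mapDomain_single, min_self,
        min_eq_right (le_self_add : s ≤ s + t)]
  rw [expUnit, expFiber_add, h_left, Finsupp.mapDomain_single, add_tsub_cancel_left, ← expUnit]

lemma isUnitSection_expUnit (hL : IsLevyProcess L P) (φ : StrongDual ℝ B) :
    hL.productSystem.IsUnitSection fun t => hL.expUnit φ t where
  measurable := by
    borelize ↥(Lp ℂ 2 P)
    refine hL.isInducedBy_productSystem.measurable_iff.2 ⟨measurable_id, ?_⟩
    have h : Continuous fun t : PosTime => (hL.expUnit φ t : Lp ℂ 2 P) := by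
      simp only [coe_expUnit]
      exact (hL.continuous_expLp_single φ).comp continuous_subtype_val
    exact h.measurable
  ne_zero := by
    refine ⟨⟨1, one_pos⟩, fun h => ?_⟩
    have h_zero : (hL.expUnit φ 1 : Lp ℂ 2 P) = 0 := congrArg Subtype.val h
    have h_ae : ∀ᵐ _ ∂P, False := by
      filter_upwards [hL.expFiber_ae_eq (.single 1 φ) 1,
        (Lp.eq_zero_iff_ae_eq_zero (f := (hL.expUnit φ 1 : Lp ℂ 2 P))).1 h_zero] with _ h₁ h₂
      exact Complex.exp_ne_zero _ (h₁.symm.trans h₂)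
    exact h_ae.exists.choose_spec
  map_add s t := hL.expUnit_add φ s t

lemma unitProduct_mulFiber (hL : IsLevyProcess L P) (φ : StrongDual ℝ B) (s : PosTime)
    {t : PosTime} {g : levyFiber L P t} (hg : hL.productSystem.UnitProduct t g) :
    hL.productSystem.UnitProduct (s + t) (hL.mulFiber (hL.expUnit φ s) g) :=
  .cons _ (hL.isUnitSection_expUnit φ) s t g hg

lemma unitProduct_expFiber (hL : IsLevyProcess L P) (ℓ : ℝ≥0 →₀ StrongDual ℝ B) (t : PosTime) :
    hL.productSystem.UnitProduct t (hL.expFiber ℓ t) := by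
  induction hn : Finset.card {u ∈ ℓ.support | 0 < u ∧ u < (t : ℝ≥0)} using
    Nat.strong_induction_on generalizing ℓ t with
  | _ n ih =>
  rcases Finset.eq_empty_or_nonempty {u ∈ ℓ.support | 0 < u ∧ u < (t : ℝ≥0)} with h | h
  · have hℓ : ∀ u ∈ ℓ.support, u = 0 ∨ (t : ℝ≥0) ≤ u := fun u hu => by
      by_contra! hu'
      exact Finset.notMem_empty u
        (h ▸ Finset.mem_filter.2 ⟨hu, pos_iff_ne_zero.2 hu'.1, hu'.2⟩)
    rw [hL.expFiber_eq_expUnit hℓ]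
    exact .single _ (hL.isUnitSection_expUnit _) t
  · obtain ⟨s, hs, hs_min⟩ := Finset.exists_minimal h
    obtain ⟨hs_mem, hs_pos, hst⟩ := Finset.mem_filter.1 hs
    obtain ⟨r, hr, hsr⟩ : ∃ r, 0 < r ∧ s + r = (t : ℝ≥0) :=
      ⟨t - s, tsub_pos_of_lt hst, add_tsub_cancel_of_le hst.le⟩
    obtain rfl : t = ⟨s, hs_pos⟩ + ⟨r, hr⟩ := Subtype.ext hsr.symm
    have hℓ : ∀ u ∈ ℓ.support, u = 0 ∨ s ≤ u := fun u hu => by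
      by_contra! hu'
      exact hu'.2.not_ge (hs_min (Finset.mem_filter.2
        ⟨hu, pos_iff_ne_zero.2 hu'.1, hu'.2.trans hst⟩) hu'.2.le)
    have h_split : hL.expFiber ℓ (s + r) = _ := hL.expFiber_add ℓ s r
    rw [hL.expFiber_eq_expUnit hℓ] at h_split
    have h_rest := ih _ (hn ▸ card_interior_mapDomain_tsub_lt hs_mem hs_pos hr)
      (ℓ.mapDomain (· - s)) ⟨r, hr⟩ rfl
    exact h_split ▸ hL.unitProduct_mulFiber _ ⟨s, hs_pos⟩ h_rest

theorem isCompletelySpatial_productSystem (hL : IsLevyProcess L P) :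
    hL.productSystem.IsCompletelySpatial := by
  refine ⟨⟨_, hL.isUnitSection_expUnit 0⟩, fun t => top_unique ?_⟩
  refine (hL.topologicalClosure_span_expFiber t).ge.trans (Submodule.topologicalClosure_mono
    (Submodule.span_mono ?_))
  rintro _ ⟨ℓ, rfl⟩
  exact hL.unitProduct_expFiber ℓ t

end IsLevyProcess

/-! ### The fibres are infinite-dimensional -/

lemma exists_orthonormal_pair {𝕜 E : Type*} [RCLike 𝕜] [NormedAddCommGroup E]
    [InnerProductSpace 𝕜 E] {x : E} (hx : ‖x‖ = 1) (h : 𝕜 ∙ x ≠ ⊤) :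
    ∃ v : Fin 2 → E, Orthonormal 𝕜 v := by
  obtain ⟨y, hy, hy_ne⟩ := (Submodule.ne_bot_iff _).1 (mt Submodule.orthogonal_eq_bot_iff.1 h)
  refine ⟨![x, (‖y‖⁻¹ : 𝕜) • y], orthonormal_vecCons_iff.2 ⟨hx, fun i => ?_, ?_⟩⟩
  · rw [Matrix.cons_val_fin_one, inner_smul_right,
      Submodule.mem_orthogonal_singleton_iff_inner_right.1 hy, mul_zero]
  · simp [norm_smul_inv_norm hy_ne]

namespace IsLevyProcess

variable {Ω : Type u} {B : Type*} [MeasurableSpace Ω] [NormedAddCommGroup B] [NormedSpace ℝ B]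
  [MeasurableSpace B] [BorelSpace B] {L : ℝ≥0 → Ω → B} {P : Measure Ω} [IsProbabilityMeasure P]

lemma expUnit_zero_ae_eq (hL : IsLevyProcess L P) (t : ℝ≥0) :
    ((hL.expUnit 0 t : Lp ℂ 2 P) : Ω → ℂ) =ᵐ[P] fun _ => 1 := by
  filter_upwards [hL.expFiber_ae_eq (.single t 0) t] with ω h
  simpa [expUnit, pathCharacter, pathPairing] using h

lemma norm_expUnit_zero (hL : IsLevyProcess L P) (t : ℝ≥0) : ‖hL.expUnit 0 t‖ = 1 := by
  rw [Submodule.coe_norm, Lp.norm_def, eLpNorm_congr_ae (hL.expUnit_zero_ae_eq t),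
    eLpNorm_const _ two_ne_zero (NeZero.ne P)]
  simp

lemma span_expUnit_zero_eq_top_of_le (hL : IsLevyProcess L P) {r t : ℝ≥0} (hrt : r ≤ t)
    (ht : ℂ ∙ hL.expUnit 0 t = ⊤) : ℂ ∙ hL.expUnit 0 r = ⊤ := by
  refine Submodule.eq_top_iff'.2 fun f => ?_
  have h_past : past L r ≤ past L t := iSup_le fun v => (measurable_past (v.2.trans hrt)).comap_le
  let g : levyFiber L P t := ⟨f, (lpMeas.aestronglyMeasurable f).mono h_past⟩
  obtain ⟨c, hc⟩ := Submodule.mem_span_singleton.1 (ht ▸ Submodule.mem_top : g ∈ _)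
  refine Submodule.mem_span_singleton.2 ⟨c, Subtype.ext ?_⟩
  have hc' := congrArg Subtype.val hc
  rw [Submodule.coe_smul, coe_expUnit, Finsupp.single_zero] at hc' ⊢
  exact hc'

variable [SecondCountableTopology B]

lemma exists_ae_eq_const_of_span_eq_top (hL : IsLevyProcess L P) {t : ℝ≥0}
    (h : ℂ ∙ hL.expUnit 0 t = ⊤) : ∃ c, L t =ᵐ[P] fun _ => c := by
  refine exists_eventuallyEq_const_of_forall_separating MeasurableSet fun U hU => ?_
  have hA : MeasurableSet[past L t] (L t ⁻¹' U) := measurable_past le_rfl hU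
  let f : levyFiber L P t :=
    ⟨_, mem_lpMeas_indicatorConstLp (c := (1 : ℂ)) (hL.past_le t) hA (measure_ne_top P _)⟩
  obtain ⟨c, hc⟩ := Submodule.mem_span_singleton.1 (h ▸ Submodule.mem_top : f ∈ ℂ ∙ hL.expUnit 0 t)
  have hf : (L t ⁻¹' U).indicator (fun _ => (1 : ℂ)) =ᵐ[P] fun _ => c := by
    have h_smul := Lp.coeFn_smul c (hL.expUnit 0 t : Lp ℂ 2 P)
    rw [← Submodule.coe_smul, hc] at h_smul
    filter_upwards [indicatorConstLp_coeFn (p := 2) (hs := hL.past_le t _ hA)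
      (hμs := measure_ne_top P _) (c := (1 : ℂ)), h_smul, hL.expUnit_zero_ae_eq t] with ω h₁ h₂ h₃
    rw [← h₁, h₂, Pi.smul_apply, h₃, smul_eq_mul, mul_one]
  by_cases hc₁ : c = 1
  · refine .inl (hf.mono fun ω hω => ?_)
    by_contra h_mem
    rw [Set.indicator_of_notMem (by exact h_mem), hc₁] at hω
    exact zero_ne_one hω
  · refine .inr (hf.mono fun ω hω h_mem => hc₁ ?_)
    exact hω.symm.trans (Set.indicator_of_mem (by exact h_mem) _)

theorem topologicalClosure_span_mulFiber (hL : IsLevyProcess L P) (s t : ℝ≥0) :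
    (Submodule.span ℂ (Set.range fun p : levyFiber L P s × levyFiber L P t =>
      hL.mulFiber p.1 p.2)).topologicalClosure = ⊤ := by
  refine top_unique ((hL.topologicalClosure_span_expFiber (s + t)).ge.trans
    (Submodule.topologicalClosure_mono (Submodule.span_mono ?_)))
  rintro _ ⟨ℓ, rfl⟩
  exact ⟨(hL.expFiber ℓ s, hL.expFiber (ℓ.mapDomain (· - s)) t), (hL.expFiber_add ℓ s t).symm⟩

lemma span_expUnit_zero_add_eq_top (hL : IsLevyProcess L P) {s t : ℝ≥0}
    (hs : ℂ ∙ hL.expUnit 0 s = ⊤) (ht : ℂ ∙ hL.expUnit 0 t = ⊤) :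
    ℂ ∙ hL.expUnit 0 (s + t) = ⊤ := by
  rw [← top_le_iff, ← hL.topologicalClosure_span_mulFiber s t]
  refine Submodule.topologicalClosure_minimal _ (Submodule.span_le.2 ?_)
    (Submodule.closed_of_finiteDimensional _)
  rintro _ ⟨⟨f, g⟩, rfl⟩
  obtain ⟨a, rfl⟩ := Submodule.mem_span_singleton.1 (hs ▸ Submodule.mem_top : f ∈ _)
  obtain ⟨b, rfl⟩ := Submodule.mem_span_singleton.1 (ht ▸ Submodule.mem_top : g ∈ _)
  refine Submodule.mem_span_singleton.2 ⟨a * b, ?_⟩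
  calc (a * b) • hL.expUnit 0 (s + t)
      = a • b • hL.mulFiber (hL.expUnit 0 s) (hL.expUnit 0 t) := by rw [expUnit_add, mul_smul]
    _ = hL.mulFiber (a • hL.expUnit 0 s) (b • hL.expUnit 0 t) := by
        rw [smul_mulFiber, mulFiber_smul]

lemma span_expUnit_zero_eq_top_of_pos (hL : IsLevyProcess L P) {s : ℝ≥0} (h_pos : 0 < s)
    (hs : ℂ ∙ hL.expUnit 0 s = ⊤) (t : ℝ≥0) : ℂ ∙ hL.expUnit 0 t = ⊤ := by
  obtain ⟨n, hn⟩ := Archimedean.arch t h_pos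
  refine hL.span_expUnit_zero_eq_top_of_le hn ?_
  clear hn
  induction n with
  | zero => exact hL.span_expUnit_zero_eq_top_of_le (by simp) hs
  | succ n ih => exact succ_nsmul s n ▸ hL.span_expUnit_zero_add_eq_top ih hs

lemma exists_orthonormal_pair_levyFiber (hL : IsLevyProcess L P)
    (hne : ∃ t, ∀ c, ¬ L t =ᵐ[P] fun _ => c) {s : ℝ≥0} (hs : 0 < s) :
    ∃ v : Fin 2 → levyFiber L P s, Orthonormal ℂ v := by
  obtain ⟨t, ht⟩ := hne
  refine exists_orthonormal_pair (hL.norm_expUnit_zero s) fun h => ?_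
  obtain ⟨c, hc⟩ :=
    hL.exists_ae_eq_const_of_span_eq_top (hL.span_expUnit_zero_eq_top_of_pos hs h t)
  exact ht c hc

lemma exists_orthonormal_two_pow (hL : IsLevyProcess L P)
    (hne : ∃ t, ∀ c, ¬ L t =ᵐ[P] fun _ => c) (n : ℕ) {t : ℝ≥0} (ht : 0 < t) :
    ∃ v : Fin (2 ^ n) → levyFiber L P t, Orthonormal ℂ v := by
  induction n generalizing t with
  | zero =>
    obtain ⟨v, hv⟩ := hL.exists_orthonormal_pair_levyFiber hne ht
    exact ⟨_, hv.comp (Fin.castLE one_le_two) (Fin.castLE_injective _)⟩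
  | succ n ih =>
    obtain ⟨v, hv⟩ := ih (half_pos ht)
    obtain ⟨w, hw⟩ := hL.exists_orthonormal_pair_levyFiber hne (half_pos ht)
    let e := (finCongr (pow_succ 2 n)).trans finProdFinEquiv.symm
    have h : ∃ v : Fin (2 ^ (n + 1)) → levyFiber L P (t / 2 + t / 2), Orthonormal ℂ v :=
      ⟨_, (hL.orthonormal_mulFiber hv hw).comp e e.injective⟩
    rwa [add_halves] at h

theorem not_finiteDimensional_levyFiber (hL : IsLevyProcess L P)
    (hne : ∃ t, ∀ c, ¬ L t =ᵐ[P] fun _ => c) {t : ℝ≥0} (ht : 0 < t) :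
    ¬ FiniteDimensional ℂ (levyFiber L P t) := by
  intro hfin
  obtain ⟨v, hv⟩ := hL.exists_orthonormal_two_pow hne (Module.finrank ℂ (levyFiber L P t)) ht
  have h_card := hv.linearIndependent.fintype_card_le_finrank
  rw [Fintype.card_fin] at h_card
  exact h_card.not_gt Nat.lt_two_pow_self

end IsLevyProcess

/-! ### Complete spatiality and non-degenerate Gaussian processes -/

namespace IsLevyProcess

variable {Ω : Type u} {B : Type*} [MeasurableSpace Ω] [NormedAddCommGroup B] [NormedSpace ℝ B]
  [MeasurableSpace B] [BorelSpace B] [SecondCountableTopology B] {L : ℝ≥0 → Ω → B}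
  {P : Measure Ω} [IsProbabilityMeasure P]

theorem isProductSystem_productSystem (hL : IsLevyProcess L P)
    (hne : ∃ t, ∀ c, ¬ L t =ᵐ[P] fun _ => c) : hL.productSystem.IsProductSystem := by
  have (t : PosTime) : CompleteSpace (hL.productSystem.Fiber t) := hL.completeSpace_levyFiber t
  have hinf (t : PosTime) : ¬ FiniteDimensional ℂ (hL.productSystem.Fiber t) :=
    hL.not_finiteDimensional_levyFiber hne t.2
  obtain ⟨ℓ, hℓ⟩ := hL.exists_seq_topologicalClosure_span_expFiber
  have hd (n : ℕ) : StronglyMeasurable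
      fun t : PosTime => (hL.expFiber (ℓ n) t : Lp ℂ 2 P) :=
    ((hL.continuous_expFiber (ℓ n)).comp continuous_subtype_val).stronglyMeasurable
  have hb (n : ℕ) : StronglyMeasurable fun q : PosTime × PosTime =>
      (hL.expFiber ((ℓ n).mapDomain (· - (q.1 : ℝ≥0))) q.2 : Lp ℂ 2 P) :=
    ((hL.continuous_expFiber_mapDomain_tsub (ℓ n)).comp
      (continuous_subtype_val.prodMap continuous_subtype_val)).stronglyMeasurable
  exact {
    trivializable := hL.isInducedBy_productSystem.isTrivializable hd (fun t => hℓ t) hinf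
    measurable_mul :=
      hL.isInducedBy_productSystem.measurable_mul
        (b := fun n s t => hL.expFiber ((ℓ n).mapDomain (· - (s : ℝ≥0))) t) hd (fun t => hℓ t)
        hinf hb (fun n s t => hL.expFiber_add (ℓ n) s t) hL.inner_mulFiber
    add_mul := hL.add_mulFiber
    mul_add := hL.mulFiber_add
    smul_mul := hL.smul_mulFiber
    mul_smul := hL.mulFiber_smul
    inner_mul := hL.inner_mulFiber
    dense_mul := fun s t => hL.topologicalClosure_span_mulFiber s t
    mul_assoc := fun f g h =>
      HilbertBundle.injective_sigma_embedding (fun t => (levyFiber L P t).subtypeₗᵢ)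
        (Prod.ext (add_assoc _ _ _).symm (hL.mulFiber_assoc f g h)) }

end IsLevyProcess

lemma exists_pos_of_nondegenerate {B : Type*} [NormedAddCommGroup B] [NormedSpace ℝ B]
    [Nontrivial B] {Q : LinearMap.BilinForm ℝ (StrongDual ℝ B)} (hQ : Q.Nondegenerate)
    (h_symm : ∀ φ ψ, Q φ ψ = Q ψ φ) (h_nonneg : ∀ φ, 0 ≤ Q φ φ) : ∃ φ, 0 < Q φ φ := by
  by_contra! h
  have h_diag (φ : StrongDual ℝ B) : Q φ φ = 0 := le_antisymm (h φ) (h_nonneg φ)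
  have h_zero (φ ψ : StrongDual ℝ B) : Q φ ψ = 0 := by
    have h_add := h_diag (φ + ψ)
    simp only [map_add, LinearMap.add_apply, h_diag, h_symm ψ φ] at h_add
    linarith
  obtain ⟨x, hx⟩ := exists_ne (0 : B)
  obtain ⟨φ, hφ⟩ := SeparatingDual.exists_ne_zero (R := ℝ) hx
  refine hφ ?_
  rw [hQ.1 φ (h_zero φ)]
  rfl

lemma re_levyExponent_zero {B : Type*} [NormedAddCommGroup B] [NormedSpace ℝ B]
    [MeasurableSpace B] (b : B) (Q : LinearMap.BilinForm ℝ (StrongDual ℝ B))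
    (φ : StrongDual ℝ B) : (levyExponent b Q 0 φ).re = -(Q φ φ / 2) := by
  simp [levyExponent, div_eq_inv_mul]

lemma HasTriplet.not_ae_eq_const {Ω B : Type*} [MeasurableSpace Ω] [NormedAddCommGroup B]
    [NormedSpace ℝ B] [MeasurableSpace B] {P : Measure Ω} [IsProbabilityMeasure P]
    {L : ℝ≥0 → Ω → B} {b : B} {Q : LinearMap.BilinForm ℝ (StrongDual ℝ B)}
    (hT : HasTriplet L P b Q 0) {φ : StrongDual ℝ B} (hφ : 0 < Q φ φ) (c : B) :
    ¬ L 1 =ᵐ[P] fun _ => c := by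
  intro hc
  have h_char : ∫ ω, Complex.exp (Complex.I * (φ (L 1 ω) : ℂ)) ∂P =
      Complex.exp (Complex.I * (φ c : ℂ)) := by
    rw [integral_congr_ae (g := fun _ => Complex.exp (Complex.I * (φ c : ℂ)))
      (hc.mono fun ω hω => by simp only [hω]), integral_const, probReal_univ, one_smul]
  have h_norm := congrArg norm (h_char.symm.trans (hT.charFun_eq 1 φ))
  rw [Complex.norm_exp, Complex.norm_exp, Real.exp_eq_exp, NNReal.coe_one, Complex.ofReal_one,
    one_mul, re_levyExponent_zero] at h_norm
  simp only [Complex.mul_re, Complex.I_re, Complex.I_im, Complex.ofReal_im] at h_norm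
  linarith

end ProductSystems

theorem mainTheorem6_general {Ω : Type*} {B : Type*} [MeasurableSpace Ω] [NormedAddCommGroup B]
    [NormedSpace ℝ B] [SecondCountableTopology B] [MeasurableSpace B] [BorelSpace B]
    (P : MeasureTheory.Measure Ω) [MeasureTheory.IsProbabilityMeasure P]
    (L : ℝ≥0 → Ω → B) (hL : ProductSystems.IsLevyProcess L P)
    (hne : ∃ t, ∀ c, ¬ L t =ᵐ[P] fun _ => c) :
    hL.productSystem.IsProductSystem ∧ hL.productSystem.IsCompletelySpatial :=
  ⟨hL.isProductSystem_productSystem hne, hL.isCompletelySpatial_productSystem⟩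

theorem mainTheorem6 {Ω : Type*} {B : Type*} [MeasurableSpace Ω] [NormedAddCommGroup B]
    [NormedSpace ℝ B] [CompleteSpace B] [SecondCountableTopology B] [Nontrivial B]
    [MeasurableSpace B] [BorelSpace B]
    (P : MeasureTheory.Measure Ω) [MeasureTheory.IsProbabilityMeasure P]
    (L : ℝ≥0 → Ω → B) (hL : ProductSystems.IsLevyProcess L P)
    (b : B) (Q : LinearMap.BilinForm ℝ (StrongDual ℝ B)) (hQ : Q.Nondegenerate)
    (hT : ProductSystems.HasTriplet L P b Q 0) :
    hL.productSystem.IsProductSystem ∧ hL.productSystem.IsCompletelySpatial := by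
  obtain ⟨φ, hφ⟩ := ProductSystems.exists_pos_of_nondegenerate hQ hT.symm hT.nonneg
  exact mainTheorem6_general P L hL ⟨1, hT.not_ae_eq_const hφ⟩
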